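/- \textbf{Theorem (randomized Glivenko--Cantelli).} Let $m,l\ge 1$ be integers and let $(\Omega_X,\mathcal F_X,P_X)$, $(\Omega_\eta,\mathcal F_\eta,P_\eta)$ be probability spaces with product $(\Omega_{X,\eta},\mathcal F_{X,\eta},P_{X,\eta})$. Let $T_1\subseteq T_2\subseteq\cdots$ be convex sets in $\mathbb R^m$ of finite Lebesgue measure, $T_n$ containing a ball of radius $r_n$, where $r_n\to\infty$. Let $k_1<k_2<\cdots$ be positive integers and, for each $n$, let $\eta_{n,1},\dots,\eta_{n,k_n}$ be independent random vectors on $\Omega_\eta$, each uniformly distributed on $T_n$ (no assumption is made on the joint distribution of different rows). A random field $X(t,\omega)$, $t\in\mathbb R^m$, $\omega\in\Omega_X$, with values in $\mathbb R^d$ is called bi-measurable if it is jointly measurable in $(t,\omega)$; homogeneous if $$P_X\{X(t_1+t)\in A_1,\dots,X(t_q+t)\in A_q\}=P_X\{X(t_1)\in A_1,\dots,X(t_q)\in A_q\}$$ for all $q$, all $t,t_1,\dots,t_q\in\mathbb R^m$ and all Borel sets $A_1,\dots,A_q\subseteq\mathbb R^d$; and ergodic if the shifts $\gamma_t x=x(\cdot+t)$,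 $t\in\mathbb R^m$, are metrically transitive for the law $\mu$ of $X$ on the space of all functions $\mathbb R^m\to\mathbb R^d$ with the $\sigma$-field generated by the evaluations: every event $A$ in this $\sigma$-field with $\mu(A\,\triangle\,\gamma_t^{-1}A)=0$ for all $t$ has $\mu(A)\in\{0,1\}$. (1) Let $\mathbf X=(X_1,\dots,X_l)$ be an $\mathbb R^l$-valued bi-measurable, homogeneous and ergodic random field, and put, for $\boldsymbol x=(x^1,\dots,x^l)\in\mathbb R^l$, $$F(\boldsymbol x)=P_X\{X_1(0)\le x^1,\dots,X_l(0)\le x^l\},\qquad F_n(\boldsymbol x;\omega,\eta)=\frac1{k_n}\sum_{i=1}^{k_n}\mathbf 1\{X_1(\eta_{n,i},\omega)\le x^1,\dots,X_l(\eta_{n,i},\omega)\le x^l\}.$$ Then, with $P_{X,\eta}$-probability $1$, $\lim_{n\to\infty}\sup_{\boldsymbol x\in\mathbb R^l}|F_n(\boldsymbol x;\omega,\eta)-F(\boldsymbol x)|=0$. (2) Let $X$ be a real-valued bi-measurable, homogeneous and ergodic random field, let $t_1,\dots,t_l\in\mathbb R^m$, and put $$F(\boldsymbol t;\boldsymbol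 x)=P_X\{X(t_1)\le x^1,\dots,X(t_l)\le x^l\},\qquad F_n(\boldsymbol t;\boldsymbol x;\omega,\eta)=\frac1{k_n}\sum_{i=1}^{k_n}\mathbf 1\{X(t_1+\eta_{n,i},\omega)\le x^1,\dots,X(t_l+\eta_{n,i},\omega)\le x^l\}.$$ Then, with $P_{X,\eta}$-probability $1$, $\lim_{n\to\infty}\sup_{\boldsymbol x\in\mathbb R^l}|F_n(\boldsymbol t;\boldsymbol x;\omega,\eta)-F(\boldsymbol t;\boldsymbol x)|=0$. -/

import Mathlib

open MeasureTheory ProbabilityTheory Filter Topology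

/-- A random field `X : T → Ω → V` is (strict-sense) homogeneous with respect to `P` if all its
finite-dimensional distributions are shift-invariant. -/
def IsHomogeneousField {T Ω V : Type*} [Add T] [MeasurableSpace Ω] [MeasurableSpace V]
    (X : T → Ω → V) (P : Measure Ω) : Prop :=
  ∀ (t : T) (q : ℕ) (s : Fin q → T) (A : Fin q → Set V), (∀ j, MeasurableSet (A j)) →
    P {ω | ∀ j, X (s j + t) ω ∈ A j} = P {ω | ∀ j, X (s j) ω ∈ A j}

/-- The law of the field `X`: the image of `P` on the space of all functions `T → V`, with the
σ-field generated by the evaluations `x ↦ x t`. -/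
noncomputable def fieldLaw {T Ω V : Type*} [MeasurableSpace Ω] [MeasurableSpace V]
    (X : T → Ω → V) (P : Measure Ω) : Measure (T → V) :=
  P.map (fun ω t => X t ω)

/-- The shift `γ_t x = x (· + t)` on the space of functions. -/
def pathShift {T V : Type*} [Add T] (t : T) (x : T → V) : T → V :=
  fun s => x (s + t)

/-- The group of shifts is metrically transitive for the law of the field: every event of the
function space which is invariant, modulo null sets, under each shift has probability 0 or 1. -/
def IsErgodicField {T Ω V : Type*} [Add T] [MeasurableSpace Ω] [MeasurableSpace V]
    (X : T → Ω → V) (P : Measure Ω) : Prop :=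
  ∀ A : Set (T → V), MeasurableSet A →
    (∀ t : T, fieldLaw X P (symmDiff A (pathShift t ⁻¹' A)) = 0) →
    fieldLaw X P A = 0 ∨ fieldLaw X P A = 1

/-- The multivariate cumulative distribution function of the random vector `V`. -/
noncomputable def multiCDF {Ω : Type*} [MeasurableSpace Ω] {l : ℕ}
    (V : Ω → Fin l → ℝ) (P : Measure Ω) (x : Fin l → ℝ) : ℝ :=
  P.real {ω | ∀ j, V ω j ≤ x j}

open scoped Classical in
/-- The empirical distribution function, at `x`, of the sample `v 0, …, v (k - 1)` in `ℝˡ`. -/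
noncomputable def empiricalCDF {l k : ℕ} (v : Fin k → Fin l → ℝ) (x : Fin l → ℝ) : ℝ :=
  (1 / (k : ℝ)) * ∑ i : Fin k, if ∀ j, v i j ≤ x j then 1 else 0

/-! Fix a Borel set `A` of values. For almost every path, the spatial average over `T n` of the
indicator of `X s ω ∈ A` tends to its probability, by the pointwise ergodic theorem. Given the path,
the random points form an independent sample from the uniform law on `T n`, so the sample frequency
is exponentially close to that average (Hoeffding). Borel–Cantelli then needs no relation between
rows, and Fubini combines both statements (`ae_tendsto_sampleFreq`). Uniformity over orthants
follows from finite bracketing (`ae_tendsto_iSup_abs_empiricalCDF_sub`).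

The ergodic theorem `ae_tendsto_average` is proved by Banach's principle. A bounded functional minus
its mean is a sum of bounded coboundaries plus an error small in L¹
(`exists_boundedCoboundaries_approx`). Averages of coboundaries vanish because large convex sets are
nearly translation invariant. The error is controlled by `maximal_ergodic_inequality`, transferred
from a Vitali covering argument on `E` that rests on doubling for convex sets.

The second claim is the first one applied to the field `s ↦ (X (t j + s))_j`. -/

open scoped Pointwise ENNReal NNReal

/-! ### Convex sets: doubling, near-invariance under translation, and the weak type maximal
inequality. -/

section Geometry

variable {E : Type*} [NormedAddCommGroup E] [NormedSpace ℝ E] [MeasurableSpace E] [BorelSpace E]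
  [FiniteDimensional ℝ E]

/-- The doubling property of convex sets: the difference body of a convex set has volume
comparable to that of the set. -/
theorem Convex.addHaar_sub_self_le (μ : Measure E) [μ.IsAddHaarMeasure] {T : Set E}
    (hT : Convex ℝ T) (hm : MeasurableSet T) (h0 : μ T ≠ 0) (hfin : μ T ≠ ∞) :
    μ (T - T) ≤ 4 ^ Module.finrank ℝ E * μ T := by
  set d := Module.finrank ℝ E with hd
  -- The covariogram `f x = μ (T ∩ (x + T))` has integral `μ T ^ 2`. It is at least `2⁻ᵈ * μ T` on
  -- `(T - T) / 2`, so Markov's inequality bounds the volume of that set.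
  let f : E → ℝ≥0∞ := fun x => ∫⁻ y, T.indicator 1 y * T.indicator 1 (y - x) ∂μ
  have hi : Measurable (T.indicator (1 : E → ℝ≥0∞)) := measurable_one.indicator hm
  have hjoint : Measurable
      (fun p : E × E => T.indicator (1 : E → ℝ≥0∞) p.2 * T.indicator 1 (p.2 - p.1)) :=
    (hi.comp measurable_snd).mul (hi.comp (measurable_snd.sub measurable_fst))
  have hf : Measurable f := hjoint.lintegral_prod_right'
  have hint : ∫⁻ x, f x ∂μ = μ T * μ T := by
    simp only [f]
    rw [lintegral_lintegral_swap hjoint.aemeasurable]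
    have h1 : ∀ y, ∫⁻ x, T.indicator (1 : E → ℝ≥0∞) y * T.indicator 1 (y - x) ∂μ
        = T.indicator 1 y * μ T := by
      intro y
      have h2 : Measurable fun x => T.indicator (1 : E → ℝ≥0∞) (y - x) :=
        hi.comp (measurable_const.sub measurable_id)
      rw [lintegral_const_mul _ h2,
        lintegral_sub_left_eq_self (μ := μ) (T.indicator (1 : E → ℝ≥0∞)) y, lintegral_indicator_one hm]
    simp_rw [h1]
    rw [lintegral_mul_const _ hi, lintegral_indicator_one hm]
  have hhalf : ∀ T' : Set E, μ ((1 / 2 : ℝ) • T') = (2⁻¹ : ℝ≥0∞) ^ d * μ T' := by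
    intro T'
    rw [Measure.addHaar_smul, abs_of_nonneg (by positivity), ENNReal.ofReal_pow (by norm_num)]
    congr 2
    rw [one_div, ENNReal.ofReal_inv_of_pos (by norm_num)]
    simp
  -- For `x = (a - b) / 2`, convexity puts `a / 2 + T / 2` inside `T ∩ (x + T)`.
  have hlow : ∀ x ∈ (1 / 2 : ℝ) • (T - T), (2⁻¹ : ℝ≥0∞) ^ d * μ T ≤ f x := by
    rintro _ ⟨_, ⟨a, ha, b, hb, rfl⟩, rfl⟩
    have hfx : f ((1 / 2 : ℝ) • (a - b)) = μ (T ∩ {y | y - (1 / 2 : ℝ) • (a - b) ∈ T}) := by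
      have h3 : MeasurableSet (T ∩ {y | y - (1 / 2 : ℝ) • (a - b) ∈ T}) :=
        hm.inter ((measurable_id.sub_const ((1 / 2 : ℝ) • (a - b))) hm)
      rw [← lintegral_indicator_one h3]
      refine lintegral_congr fun y => ?_
      by_cases h1 : y ∈ T <;> by_cases h2 : y - (1 / 2 : ℝ) • (a - b) ∈ T <;>
        simp_all [Set.indicator]
    change _ ≤ f ((1 / 2 : ℝ) • (a - b))
    rw [hfx]
    calc (2⁻¹ : ℝ≥0∞) ^ d * μ T = μ ((1 / 2 : ℝ) • T) := (hhalf T).symm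
      _ = μ ((1 / 2 : ℝ) • a +ᵥ (1 / 2 : ℝ) • T) := (measure_vadd μ _ _).symm
      _ ≤ _ := by
        refine measure_mono ?_
        rintro _ ⟨_, ⟨t, ht, rfl⟩, rfl⟩
        refine ⟨hT ha ht (by norm_num) (by norm_num) (by norm_num), ?_⟩
        have := hT hb ht (a := 1 / 2) (b := 1 / 2) (by norm_num) (by norm_num) (by norm_num)
        change (1 / 2 : ℝ) • a + (1 / 2 : ℝ) • t - (1 / 2 : ℝ) • (a - b) ∈ T
        convert this using 1
        rw [smul_sub]
        abel
  have hmarkov := mul_meas_ge_le_lintegral (μ := μ) hf ((2⁻¹ : ℝ≥0∞) ^ d * μ T)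
  have h2 : (2⁻¹ : ℝ≥0∞) ^ d * μ T * ((2⁻¹ : ℝ≥0∞) ^ d * μ (T - T)) ≤ μ T * μ T := by
    rw [← hhalf (T - T), ← hint]
    exact (mul_le_mul_right (measure_mono hlow) _).trans hmarkov
  have h3 : (4 : ℝ≥0∞) ^ d * ((2⁻¹ : ℝ≥0∞) ^ d * (2⁻¹ : ℝ≥0∞) ^ d) = 1 := by
    rw [← mul_pow, ← mul_pow]
    have : (4 : ℝ≥0∞) * (2⁻¹ * 2⁻¹) = 1 := by
      rw [show (4 : ℝ≥0∞) = 2 * 2 by norm_num, mul_mul_mul_comm,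
        ENNReal.mul_inv_cancel (by norm_num) (by norm_num), one_mul]
    rw [this, one_pow]
  refine (ENNReal.mul_le_mul_iff_right h0 hfin).1 ?_
  calc μ T * μ (T - T)
      = 4 ^ d * ((2⁻¹ : ℝ≥0∞) ^ d * (2⁻¹ : ℝ≥0∞) ^ d) * (μ T * μ (T - T)) := by rw [h3, one_mul]
    _ = 4 ^ d * ((2⁻¹ : ℝ≥0∞) ^ d * μ T * ((2⁻¹ : ℝ≥0∞) ^ d * μ (T - T))) := by ring
    _ ≤ 4 ^ d * (μ T * μ T) := by gcongr
    _ = μ T * (4 ^ d * μ T) := by ring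

/-- A convex set which contains a large ball is almost invariant under a fixed translation. -/
theorem Convex.addHaar_union_vadd_le (μ : Measure E) [μ.IsAddHaarMeasure] {T : Set E}
    (hT : Convex ℝ T) {c : E} {r : ℝ} (hr : 0 < r) (hball : Metric.ball c r ⊆ T) (h : E) :
    μ (T ∪ (h +ᵥ T))
      ≤ ENNReal.ofReal ((1 + (‖h‖ + 1) / r) ^ Module.finrank ℝ E) * μ T := by
  -- The summand 1 keeps `a` positive when `h = 0` and puts `c + a⁻¹ • h` strictly inside the ball.
  set a : ℝ := (‖h‖ + 1) / r with ha
  have hδ : 0 < ‖h‖ + 1 := by positivity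
  have ha0 : 0 < a := by positivity
  have hc : c ∈ T := hball (Metric.mem_ball_self hr)
  have hb : c + a⁻¹ • h ∈ T := by
    apply hball
    rw [Metric.mem_ball, dist_eq_norm, add_sub_cancel_left, norm_smul, norm_inv, Real.norm_of_nonneg ha0.le,
      ha, inv_div, div_mul_eq_mul_div, div_lt_iff₀ hδ]
    nlinarith
  -- Taking `b = c` gives `t`, and `b = c + a⁻¹ • h` gives `h + t`, so one translate of `(1 + a) •
  -- T` contains both `T` and `h + T`.
  have key : ∀ t ∈ T, ∀ b ∈ T, t + a • b - a • c ∈ (-(a • c)) +ᵥ ((1 + a) • T) := by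
    intro t ht b hb
    refine ⟨t + a • b, ⟨(1 + a)⁻¹ • t + (a * (1 + a)⁻¹) • b, ?_, ?_⟩, ?_⟩
    · exact hT ht hb (by positivity) (by positivity) (by field_simp)
    · simp only [smul_add, smul_smul]
      rw [mul_inv_cancel₀ (by positivity), one_smul, mul_left_comm,
        mul_inv_cancel₀ (by positivity), mul_one]
    · simp only [vadd_eq_add]; abel
  calc μ (T ∪ (h +ᵥ T)) ≤ μ ((-(a • c)) +ᵥ ((1 + a) • T)) := by
        refine measure_mono (Set.union_subset ?_ ?_)
        · intro t ht
          simpa using key t ht c hc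
        · rintro _ ⟨t, ht, rfl⟩
          have := key t ht _ hb
          rwa [smul_add, smul_smul, mul_inv_cancel₀ ha0.ne', one_smul,
            show t + (a • c + h) - a • c = h + t by abel] at this
    _ = _ := by
        rw [measure_vadd, Measure.addHaar_smul, abs_of_nonneg (by positivity)]

omit [NormedSpace ℝ E] [FiniteDimensional ℝ E] in
theorem setLIntegral_add_left_eq (μ : Measure E) [μ.IsAddHaarMeasure] {T : Set E}
    (hm : MeasurableSet T) (φ : E → ℝ≥0∞) (t : E) :
    ∫⁻ s in T, φ (t + s) ∂μ = ∫⁻ y in t +ᵥ T, φ y ∂μ := by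
  rw [← lintegral_indicator hm, ← lintegral_indicator (hm.const_vadd t),
    ← lintegral_add_left_eq_self ((t +ᵥ T).indicator φ) t]
  refine lintegral_congr fun s => ?_
  have : t + s ∈ t +ᵥ T ↔ s ∈ T := by
    rw [← vadd_eq_add, Set.vadd_mem_vadd_set_iff]
  by_cases h : s ∈ T <;> simp [Set.indicator, this, h]

/-- The weak type maximal inequality for averages over translates of increasing convex sets. -/
theorem maximal_weak_type (μ : Measure E) [μ.IsAddHaarMeasure] {T : ℕ → Set E}
    (hmono : Monotone T) (hconv : ∀ n, Convex ℝ (T n)) (hopen : ∀ n, IsOpen (T n))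
    (hne : ∀ n, (T n).Nonempty) (hfin : ∀ n, μ (T n) ≠ ∞) (N : ℕ) (K : Set E) (φ : E → ℝ≥0∞)
    (lam : ℝ≥0∞) :
    lam * μ {t ∈ K | ∃ n ≤ N, lam * μ (T n) ≤ ∫⁻ s in T n, φ (t + s) ∂μ}
      ≤ 4 ^ Module.finrank ℝ E * ∫⁻ x in K + T N, φ x ∂μ := by
  set d := Module.finrank ℝ E
  let B : E × ℕ → Set E := fun p => p.1 +ᵥ T p.2
  let A : Set (E × ℕ) :=
    {p | p.1 ∈ K ∧ p.2 ≤ N ∧ lam * μ (T p.2) ≤ ∫⁻ s in T p.2, φ (p.1 + s) ∂μ}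
  -- The size of a translate of `T n` is taken to be `4 ^ n`. As the enlargement factor 2 is below
  -- 4, each discarded translate meets a selected one of no smaller index; by monotonicity its base
  -- point then lies in `p.1 + (T p.2 - T p.2)`.
  obtain ⟨u, huA, hdisj, hcov⟩ := Vitali.exists_disjoint_subfamily_covering_enlargement B A
    (fun p => (4 : ℝ) ^ p.2) 2 (by norm_num) (fun p _ => by positivity) (4 ^ N)
    (fun p hp => pow_le_pow_right₀ (by norm_num) hp.2.1) (fun p _ => (hne p.2).vadd_set)
  have hBopen : ∀ p, IsOpen (B p) := fun p => (hopen p.2).vadd p.1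
  have hcount : u.Countable := hdisj.countable_of_nonempty_interior fun p _ => by
    rw [(hBopen p).interior_eq]; exact (hne p.2).vadd_set
  have hsub : {t ∈ K | ∃ n ≤ N, lam * μ (T n) ≤ ∫⁻ s in T n, φ (t + s) ∂μ}
      ⊆ ⋃ p ∈ u, (p.1 +ᵥ (T p.2 - T p.2)) := by
    rintro t ⟨htK, n, hn, hlt⟩
    obtain ⟨p, hpu, ⟨z, ⟨y, hy, hyz⟩, ⟨w, hw, hwz⟩⟩, hδ⟩ := hcov (t, n) ⟨htK, hn, hlt⟩
    have hnp : n ≤ p.2 := by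
      by_contra! hcon
      have h1 : (4 : ℝ) ^ (p.2 + 1) ≤ 4 ^ n := pow_le_pow_right₀ (by norm_num) hcon
      have h2 : (0 : ℝ) < 4 ^ p.2 := by positivity
      simp only at hδ
      rw [pow_succ] at h1
      linarith
    refine Set.mem_biUnion hpu ⟨w - y, ⟨w, hw, y, hmono hnp hy, rfl⟩, ?_⟩
    simp only [vadd_eq_add] at hyz hwz ⊢
    rw [← add_sub_assoc, hwz, ← hyz, add_sub_cancel_right]
  have := hcount.to_subtype
  calc lam * μ {t ∈ K | ∃ n ≤ N, lam * μ (T n) ≤ ∫⁻ s in T n, φ (t + s) ∂μ}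
      ≤ lam * ∑' p : u, μ (p.1.1 +ᵥ (T p.1.2 - T p.1.2)) := by
        gcongr
        exact (measure_mono hsub).trans (measure_biUnion_le μ hcount _)
    _ ≤ lam * ∑' p : u, 4 ^ d * μ (T p.1.2) := by
        gcongr with p
        rw [measure_vadd]
        exact (hconv _).addHaar_sub_self_le μ (hopen _).measurableSet
          ((hopen _).measure_pos μ (hne _)).ne' (hfin _)
    _ = 4 ^ d * ∑' p : u, lam * μ (T p.1.2) := by
        rw [ENNReal.tsum_mul_left, ENNReal.tsum_mul_left]; ring
    _ ≤ 4 ^ d * ∑' p : u, ∫⁻ y in B p, φ y ∂μ := by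
        gcongr with p
        rw [← setLIntegral_add_left_eq μ (hopen _).measurableSet]
        exact (huA p.2).2.2
    _ = 4 ^ d * ∫⁻ y in ⋃ p ∈ u, B p, φ y ∂μ := by
        rw [lintegral_biUnion hcount (fun p _ => (hBopen p).measurableSet) hdisj]
    _ ≤ 4 ^ d * ∫⁻ x in K + T N, φ x ∂μ := by
        gcongr
        refine Set.iUnion₂_subset fun p hp => ?_
        rintro _ ⟨s, hs, rfl⟩
        exact ⟨p.1, (huA hp).1, s, hmono (huA hp).2.1 hs, rfl⟩

/-- Averages of a bounded function over a convex set containing a large ball are almost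
translation invariant. -/
theorem abs_average_add_sub_average_le (μ : Measure E) [μ.IsAddHaarMeasure] {T : Set E}
    (hT : Convex ℝ T) (hm : MeasurableSet T) (h0 : μ T ≠ 0) (hfin : μ T ≠ ∞) {c : E} {r : ℝ}
    (hr : 0 < r) (hball : Metric.ball c r ⊆ T) {f : E → ℝ} (hf : Measurable f) {M : ℝ}
    (hM : ∀ x, |f x| ≤ M) (h : E) :
    |∫ s, f (h + s) ∂μ[|T] - ∫ s, f s ∂μ[|T]|
      ≤ 2 * M * ((1 + (‖h‖ + 1) / r) ^ Module.finrank ℝ E - 1) := by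
  set a := (1 + (‖h‖ + 1) / r) ^ Module.finrank ℝ E with ha
  set U := T ∪ (h +ᵥ T) with hU
  have hmT' : MeasurableSet (h +ᵥ T) := hm.const_vadd h
  have hUle : μ U ≤ ENNReal.ofReal a * μ T := hT.addHaar_union_vadd_le μ hr hball h
  have hUfin : μ U ≠ ∞ := (hUle.trans_lt (ENNReal.mul_lt_top ENNReal.ofReal_lt_top hfin.lt_top)).ne
  have hpos : 0 < μ.real T := ENNReal.toReal_pos h0 hfin
  have ha1 : 0 ≤ a := by positivity
  have hUreal : μ.real U ≤ a * μ.real T := by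
    have := ENNReal.toReal_mono (ENNReal.mul_ne_top ENNReal.ofReal_ne_top hfin) hUle
    rwa [ENNReal.toReal_mul, ENNReal.toReal_ofReal ha1] at this
  have hintU : IntegrableOn f U μ := by
    refine Measure.integrableOn_of_bounded (M := M) hUfin hf.aestronglyMeasurable ?_
    exact Eventually.of_forall hM
  have hT' : μ.real (h +ᵥ T) = μ.real T := by simp [Measure.real, measure_vadd]
  -- The integrals over `T` and `h + T` are both compared with the one over their union `U`, which
  -- exceeds either set by little volume.
  have step : ∀ S : Set E, MeasurableSet S → S ⊆ U → μ.real S = μ.real T →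
      |∫ x in U, f x ∂μ - ∫ x in S, f x ∂μ| ≤ M * ((a - 1) * μ.real T) := by
    intro S hS hSU hST
    have hM0 : 0 ≤ M := (abs_nonneg _).trans (hM 0)
    have h1 : ∫ x in U \ S, f x ∂μ = ∫ x in U, f x ∂μ - ∫ x in S, f x ∂μ :=
      setIntegral_sdiff hS hintU hSU
    rw [← h1]
    have h2 := norm_setIntegral_le_of_norm_le_const (μ := μ) (s := U \ S) (f := f) (C := M)
      ((measure_mono Set.sdiff_subset).trans_lt hUfin.lt_top) (fun x _ => hM x)
    refine h2.trans ?_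
    have h3 : μ.real (U \ S) = μ.real U - μ.real S := measureReal_sdiff hSU hS hUfin
    rw [h3, hST]
    gcongr
    linarith
  have htrans : ∫ s in T, f (h + s) ∂μ = ∫ y in h +ᵥ T, f y ∂μ := by
    rw [← integral_indicator hm, ← integral_indicator hmT', ← integral_add_left_eq_self ((h +ᵥ T).indicator f) h]
    refine integral_congr_ae (Eventually.of_forall fun s => ?_)
    have : h + s ∈ h +ᵥ T ↔ s ∈ T := by
      rw [← vadd_eq_add, Set.vadd_mem_vadd_set_iff]
    by_cases hs : s ∈ T <;> simp [Set.indicator, this, hs]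
  simp only [ProbabilityTheory.cond, integral_smul_measure, htrans, ← smul_sub]
  rw [smul_eq_mul, abs_mul, ENNReal.toReal_inv, ← Measure.real, abs_of_pos (inv_pos.2 hpos),
    inv_mul_le_iff₀ hpos]
  have e1 := step T hm Set.subset_union_left rfl
  have e2 := step (h +ᵥ T) hmT' Set.subset_union_right hT'
  rw [abs_le] at *
  constructor <;> nlinarith

end Geometry

/-! ### Shifts on path space and invariance of the field law. -/

section Paths

variable {E : Type*} [AddCommGroup E] [MeasurableSpace E]
  {Ω : Type*} [MeasurableSpace Ω] {V : Type*} [MeasurableSpace V] {X : E → Ω → V}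

omit [MeasurableSpace E] in
theorem measurable_pathShift (t : E) : Measurable (pathShift t : (E → V) → E → V) :=
  measurable_pi_lambda _ fun s => measurable_pi_apply (s + t)

theorem measurable_pathShift_path [MeasurableAdd₂ E] (hX : Measurable fun p : E × Ω => X p.1 p.2) :
    Measurable fun p : E × Ω => pathShift p.1 fun t => X t p.2 :=
  measurable_pi_lambda _ fun _ =>
    hX.comp ((measurable_const.add measurable_fst).prodMk measurable_snd)

omit [AddCommGroup E] in
theorem measurable_path (hX : Measurable fun p : E × Ω => X p.1 p.2) :
    Measurable fun ω => fun t => X t ω :=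
  measurable_pi_lambda _ fun _ => hX.comp (measurable_const.prodMk measurable_id)

omit [MeasurableSpace E] [MeasurableSpace V] in
theorem pathShift_add (s t : E) (x : E → V) : pathShift (s + t) x = pathShift s (pathShift t x) := by
  funext r
  simp [pathShift, add_assoc]

variable {P : Measure Ω} [IsProbabilityMeasure P]

omit [AddCommGroup E] in
theorem isProbabilityMeasure_fieldLaw (hX : Measurable fun p : E × Ω => X p.1 p.2) :
    IsProbabilityMeasure (fieldLaw X P) :=
  Measure.isProbabilityMeasure_map (measurable_path hX).aemeasurable

/-- Homogeneity is exactly agreement of the two measures on finite-dimensional rectangles, a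
π-system generating the evaluation σ-field. -/
theorem IsHomogeneousField.measurePreserving (hX : Measurable fun p : E × Ω => X p.1 p.2)
    (hom : IsHomogeneousField X P) (t : E) :
    MeasurePreserving (pathShift t) (fieldLaw X P) (fieldLaw X P) := by
  have := isProbabilityMeasure_fieldLaw (P := P) hX
  have hpath := measurable_path hX
  have hsh : Measurable (pathShift t : (E → V) → E → V) := measurable_pathShift t
  refine ⟨hsh, ?_⟩
  have := Measure.isProbabilityMeasure_map (μ := fieldLaw X P) hsh.aemeasurable
  refine ext_of_generate_finite _ (generateFrom_squareCylinders (α := fun _ : E => V)).symm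
    (isPiSystem_squareCylinders (fun _ => MeasurableSpace.isPiSystem_measurableSet)
      fun _ => MeasurableSet.univ) ?_ (by simp)
  rintro _ ⟨s, A, hA, rfl⟩
  have hA' : ∀ i, MeasurableSet (A i) := fun i => hA i (Set.mem_univ _)
  have hmeas : MeasurableSet ((s : Set E).pi A) :=
    MeasurableSet.pi s.countable_toSet fun i _ => hA' i
  rw [Measure.map_apply hsh hmeas, fieldLaw, Measure.map_apply hpath (hsh hmeas),
    Measure.map_apply hpath hmeas]
  have key := hom t s.card (fun j => (s.equivFin.symm j : E)) (fun j => A (s.equivFin.symm j))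
    fun j => hA' _
  have e : ∀ p : E → Prop, (∀ j, p (s.equivFin.symm j : E)) ↔ ∀ i ∈ s, p i := by
    intro p
    refine ⟨fun h i hi => by simpa using h (s.equivFin ⟨i, hi⟩), fun h j => h _ (Subtype.prop _)⟩
  convert key using 2
  · ext ω
    exact (e fun i => X (i + t) ω ∈ A i).symm
  · ext ω
    exact (e fun i => X i ω ∈ A i).symm

end Paths

/-! ### Mean ergodic theorem by orthogonality in L². -/

section MeanErgodic

variable {M H : Type*} [MeasurableSpace M] {μ : Measure M} [IsProbabilityMeasure μ]
  {θ : H → M → M}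

/-- The span of the bounded coboundaries of a family of transformations. -/
def boundedCoboundaries (θ : H → M → M) : Submodule ℝ (M → ℝ) :=
  Submodule.span ℝ {k | ∃ (h : H) (W : M → ℝ), Measurable W ∧ (∃ C, ∀ x, |W x| ≤ C) ∧
    k = fun x => W x - W (θ h x)}

omit [IsProbabilityMeasure μ] in
theorem measurable_and_bounded_of_mem_boundedCoboundaries
    (hθ : ∀ h, MeasurePreserving (θ h) μ μ) {k : M → ℝ} (hk : k ∈ boundedCoboundaries θ) :
    Measurable k ∧ ∃ C, ∀ x, |k x| ≤ C := by
  induction hk using Submodule.span_induction with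
  | mem k hk =>
    obtain ⟨h, W, hW, ⟨C, hC⟩, rfl⟩ := hk
    refine ⟨hW.sub (hW.comp (hθ h).measurable), C + C, fun x => ?_⟩
    exact (abs_sub _ _).trans (add_le_add (hC _) (hC _))
  | zero => exact ⟨measurable_zero, 0, fun x => by simp⟩
  | add f g _ _ hf hg =>
    obtain ⟨hf, C, hC⟩ := hf
    obtain ⟨hg, D, hD⟩ := hg
    exact ⟨hf.add hg, C + D, fun x => (abs_add_le _ _).trans (add_le_add (hC x) (hD x))⟩
  | smul a f _ hf =>
    obtain ⟨hf, C, hC⟩ := hf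
    refine ⟨hf.const_smul a, |a| * C, fun x => ?_⟩
    rw [Pi.smul_apply, smul_eq_mul, abs_mul]
    gcongr
    exact hC x

/-- A function invariant modulo null sets under a metrically transitive family is constant. -/
theorem ae_eq_const_of_forall_comp_ae_eq
    (herg : ∀ A, MeasurableSet A → (∀ h, μ (symmDiff A (θ h ⁻¹' A)) = 0) → μ A = 0 ∨ μ A = 1)
    {f : M → ℝ} (hf : Measurable f) (hinv : ∀ h, (fun x => f (θ h x)) =ᵐ[μ] f) :
    ∃ a, f =ᵐ[μ] fun _ => a := by
  -- It suffices that the preimage of each measurable set is null or conull.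
  refine Filter.exists_eventuallyEq_const_of_forall_separating MeasurableSet fun U hU => ?_
  have hA := hf hU
  have hsymm : ∀ h, μ (symmDiff (f ⁻¹' U) (θ h ⁻¹' (f ⁻¹' U))) = 0 := fun h => by
    rw [measure_symmDiff_eq_zero_iff]
    filter_upwards [hinv h] with x hx
    refine propext ?_
    change f x ∈ U ↔ f (θ h x) ∈ U
    rw [hx]
  rcases herg (f ⁻¹' U) hA hsymm with h0 | h1
  · right
    exact measure_eq_zero_iff_ae_notMem.1 h0
  · left
    exact (prob_compl_eq_zero_iff hA).2 h1

/-- Mean ergodic theorem: modulo an error small in mean, a bounded function differs from its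
integral by a sum of bounded coboundaries. -/
theorem exists_boundedCoboundaries_approx
    (hθ : ∀ h, MeasurePreserving (θ h) μ μ)
    (herg : ∀ A, MeasurableSet A → (∀ h, μ (symmDiff A (θ h ⁻¹' A)) = 0) → μ A = 0 ∨ μ A = 1)
    {g : M → ℝ} (hg : Measurable g) {C : ℝ} (hC : ∀ x, |g x| ≤ C) {ε : ℝ≥0∞} (hε : ε ≠ 0) :
    ∃ k ∈ boundedCoboundaries θ, ∫⁻ x, ‖g x - ∫ y, g y ∂μ - k x‖ₑ ∂μ < ε := by
  have hLp : ∀ k ∈ boundedCoboundaries θ, MemLp k 2 μ := fun k hk => by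
    obtain ⟨hm, D, hD⟩ := measurable_and_bounded_of_mem_boundedCoboundaries hθ hk
    exact MemLp.of_bound hm.aestronglyMeasurable D (Eventually.of_forall hD)
  let K : Submodule ℝ (Lp ℝ 2 μ) :=
    { carrier := {f | ∃ k ∈ boundedCoboundaries θ, f =ᵐ[μ] k}
      zero_mem' := ⟨0, zero_mem _, Lp.coeFn_zero _ _ _⟩
      add_mem' := by
        rintro f f' ⟨k, hk, hfk⟩ ⟨k', hk', hfk'⟩
        exact ⟨k + k', add_mem hk hk', (Lp.coeFn_add f f').trans (hfk.add hfk')⟩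
      smul_mem' := by
        rintro a f ⟨k, hk, hfk⟩
        exact ⟨a • k, Submodule.smul_mem _ a hk, (Lp.coeFn_smul a f).trans (hfk.const_smul a)⟩ }
  let U : H → Lp ℝ 2 μ → Lp ℝ 2 μ := fun h => Lp.compMeasurePreserving (θ h) (hθ h)
  have hUae : ∀ h f, U h f =ᵐ[μ] fun x => f (θ h x) := fun h f =>
    Lp.coeFn_compMeasurePreserving f (hθ h)
  have hUiso : ∀ h, Isometry (U h) := fun h => by
    exact Lp.isometry_compMeasurePreserving (hθ h)
  have hUnorm : ∀ h f, ‖U h f‖ = ‖f‖ := fun h f => Lp.norm_compMeasurePreserving f (hθ h)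
  -- Coboundaries in `K` come from bounded functions, so simple functions are treated here; their
  -- density in L² extends orthogonality to every `w` below.
  have hsimple : ∀ h (w : Lp.simpleFunc ℝ 2 μ), (w : Lp ℝ 2 μ) - U h w ∈ K := by
    intro h w
    let W := Lp.simpleFunc.toSimpleFunc w
    have hW : (w : Lp ℝ 2 μ) =ᵐ[μ] W := (Lp.simpleFunc.toSimpleFunc_eq_toFun w).symm
    refine ⟨fun x => W x - W (θ h x), Submodule.subset_span ⟨h, W, W.measurable, ?_, rfl⟩, ?_⟩
    · obtain ⟨D, hD⟩ := W.exists_forall_norm_le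
      exact ⟨D, hD⟩
    · filter_upwards [Lp.coeFn_sub (w : Lp ℝ 2 μ) (U h w), hUae h w, hW,
        (hθ h).quasiMeasurePreserving.ae_eq_comp hW] with x h1 h2 h3 h4
      simp only [Function.comp_apply] at h4
      rw [h1, Pi.sub_apply, h2, h3, h4]
  have hconst : ∀ f ∈ Kᗮ, ∃ a : ℝ, f =ᵐ[μ] fun _ => a := by
    intro f hf
    have hall : ∀ h (w : Lp ℝ 2 μ), inner ℝ (w - U h w) f = 0 := by
      intro h
      have hd : DenseRange (Subtype.val : Lp.simpleFunc ℝ 2 μ → Lp ℝ 2 μ) :=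
        Lp.simpleFunc.denseRange (by norm_num)
      have hcont : Continuous fun w : Lp ℝ 2 μ => (inner ℝ (w - U h w) f : ℝ) :=
        (continuous_id.sub (hUiso h).continuous).inner continuous_const
      refine congrFun (hd.equalizer hcont continuous_const (funext fun w => ?_))
      exact (Submodule.mem_orthogonal K f).1 hf _ (hsimple h w)
    -- Orthogonality to `f - U h f` gives `‖f‖² = ⟪U h f, f⟫`; with `‖U h f‖ = ‖f‖` this forces `‖U
    -- h f - f‖ = 0`.
    have hinv : ∀ h, U h f = f := by
      intro h
      have h1 := hall h f
      rw [inner_sub_left, real_inner_self_eq_norm_sq, sub_eq_zero] at h1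
      have h2 := norm_sub_sq_real (U h f) f
      rw [← h1, hUnorm] at h2
      have h3 : ‖U h f - f‖ ^ 2 = 0 := by rw [h2]; ring
      exact sub_eq_zero.1 (norm_eq_zero.1 (pow_eq_zero_iff (two_ne_zero)|>.1 h3))
    obtain ⟨f', hf', hff'⟩ := (Lp.aestronglyMeasurable f).aemeasurable
    obtain ⟨a, ha⟩ := ae_eq_const_of_forall_comp_ae_eq herg hf' fun h => by
      have h1 := hUae h f
      rw [hinv h] at h1
      have h2 := (hθ h).quasiMeasurePreserving.ae_eq_comp hff'
      filter_upwards [h1, h2, hff'] with x h1 h2 h3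
      simp only [Function.comp_apply] at h2
      rw [← h2, ← h1, h3]
    exact ⟨a, hff'.trans ha⟩
  set c := ∫ y, g y ∂μ
  have hgc : MemLp (fun x => g x - c) 2 μ :=
    MemLp.of_bound (hg.sub_const c).aestronglyMeasurable (C + |c|) (Eventually.of_forall fun x =>
      (abs_sub _ _).trans (by gcongr; exact hC x))
  -- The closure of `K` is `Kᗮᗮ`, and `Kᗮ` consists of constants, to which the centred function is
  -- orthogonal.
  have hmem : hgc.toLp _ ∈ K.topologicalClosure := by
    rw [← Submodule.orthogonal_orthogonal_eq_closure, Submodule.mem_orthogonal]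
    intro f hf
    obtain ⟨a, ha⟩ := hconst f hf
    rw [L2.inner_def]
    have : (fun x => inner ℝ (f x) (hgc.toLp _ x)) =ᵐ[μ] fun x => a * (g x - c) := by
      filter_upwards [ha, hgc.coeFn_toLp] with x h1 h2
      rw [h1, h2]
      simp [mul_comm]
    have hgint : Integrable g μ :=
      Integrable.of_bound hg.aestronglyMeasurable C (Eventually.of_forall hC)
    rw [integral_congr_ae this, integral_const_mul, integral_sub hgint (integrable_const _)]
    simp [c]
  rw [← SetLike.mem_coe, Submodule.topologicalClosure_coe, EMetric.mem_closure_iff] at hmem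
  obtain ⟨f, ⟨k, hk, hfk⟩, hlt⟩ := hmem ε (pos_iff_ne_zero.2 hε)
  refine ⟨k, hk, ?_⟩
  have hkm := (measurable_and_bounded_of_mem_boundedCoboundaries hθ hk).1
  have h1 : eLpNorm (fun x => g x - c - k x) 2 μ < ε := by
    rw [Lp.edist_def] at hlt
    convert hlt using 1
    refine eLpNorm_congr_ae ?_
    filter_upwards [hfk, hgc.coeFn_toLp] with x h1 h2
    rw [Pi.sub_apply, h1, h2]
  calc _ = eLpNorm (fun x => g x - c - k x) 1 μ := eLpNorm_one_eq_lintegral_enorm.symm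
    _ ≤ eLpNorm (fun x => g x - c - k x) 2 μ :=
      eLpNorm_le_eLpNorm_of_exponent_le (by norm_num)
        ((hg.sub_const c).sub hkm).aestronglyMeasurable
    _ < ε := h1

end MeanErgodic

/-! ### Replacing integrals by limits along a fixed countable set of points. -/

section Sampling

/-- Averages of a bounded random field are almost surely limits of sample means along a
deterministic sequence of points, which can be chosen to serve two fields at once. -/
theorem exists_seq_tendsto_sample_mean {E Ω : Type*} [MeasurableSpace E] [MeasurableSpace Ω]
    {P : Measure Ω} [IsProbabilityMeasure P] (ν : Measure E) [IsProbabilityMeasure ν]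
    {Z Z' : E × Ω → ℝ} (hZ : Measurable Z) (hZ' : Measurable Z') {C : ℝ}
    (hC : ∀ p, |Z p| ≤ C) (hC' : ∀ p, |Z' p| ≤ C) :
    ∃ u : ℕ → E, ∀ᵐ ω ∂P,
      Tendsto (fun n : ℕ => (∑ i ∈ Finset.range n, Z (u i, ω)) / n) atTop
        (𝓝 (∫ s, Z (s, ω) ∂ν)) ∧
      Tendsto (fun n : ℕ => (∑ i ∈ Finset.range n, Z' (u i, ω)) / n) atTop
        (𝓝 (∫ s, Z' (s, ω) ∂ν)) := by
  -- The points are drawn independently from `ν`. The strong law holds for each fixed `ω`;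
  -- exchanging the quantifiers by Fubini, almost every sequence serves almost every `ω`.
  let ρ : Measure (ℕ → E) := Measure.infinitePi fun _ : ℕ => ν
  have key : ∀ Y : E × Ω → ℝ, Measurable Y → (∀ p, |Y p| ≤ C) → ∀ᵐ u ∂ρ, ∀ᵐ ω ∂P,
      Tendsto (fun n : ℕ => (∑ i ∈ Finset.range n, Y (u i, ω)) / n) atTop
        (𝓝 (∫ s, Y (s, ω) ∂ν)) := by
    intro Y hY hYC
    have hm : MeasurableSet {p : (ℕ → E) × Ω |
        Tendsto (fun n : ℕ => (∑ i ∈ Finset.range n, Y (p.1 i, p.2)) / n) atTop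
          (𝓝 (∫ s, Y (s, p.2) ∂ν))} := by
      refine measurableSet_tendsto_fun (fun n => ?_) ?_
      · exact (Finset.measurable_fun_sum _ fun i _ => hY.comp
          (((measurable_pi_apply i).comp measurable_fst).prodMk measurable_snd)).div_const _
      · exact (hY.stronglyMeasurable.integral_prod_left' (μ := ν)).measurable.comp measurable_snd
    refine (Measure.ae_ae_comm hm).2 (Eventually.of_forall fun ω => ?_)
    have hYω : Measurable fun s => Y (s, ω) := hY.comp (measurable_id.prodMk measurable_const)
    have hmap : ∀ i, ρ.map (fun u => u i) = ν := fun i => by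
      exact Measure.infinitePi_map_eval (fun _ : ℕ => ν) i
    have hind : iIndepFun (fun (i : ℕ) (u : ℕ → E) => Y (u i, ω)) ρ :=
      iIndepFun_infinitePi (P := fun _ : ℕ => ν) (X := fun _ s => Y (s, ω)) fun _ => hYω
    have hslln := strong_law_ae_real (μ := ρ) (fun (i : ℕ) (u : ℕ → E) => Y (u i, ω))
      (Integrable.of_bound (hYω.comp (measurable_pi_apply 0)).aestronglyMeasurable C
        (Eventually.of_forall fun u => hYC _))
      (fun i j hij => hind.indepFun hij)
      (fun i => ⟨(hYω.comp (measurable_pi_apply i)).aemeasurable,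
        (hYω.comp (measurable_pi_apply 0)).aemeasurable, by
          have h : ∀ i, ρ.map (fun u => Y (u i, ω)) = ν.map fun s => Y (s, ω) := fun i => by
            rw [← hmap i, Measure.map_map hYω (measurable_pi_apply i)]
            rfl
          rw [h, h]⟩)
    have hint : ∫ u, Y (u 0, ω) ∂ρ = ∫ s, Y (s, ω) ∂ν := by
      rw [← hmap 0, integral_map (measurable_pi_apply 0).aemeasurable hYω.aestronglyMeasurable]
    rwa [hint] at hslln
  obtain ⟨u, h1, h2⟩ := ((key Z hZ hC).and (key Z' hZ' hC')).exists
  exact ⟨u, h1.and h2⟩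

end Sampling

/-! ### Stationarity of spatial averages. -/

section Averages

variable {E : Type*} [AddCommGroup E] [MeasurableSpace E] [MeasurableAdd₂ E]
  {Ω : Type*} [MeasurableSpace Ω] {V : Type*} [MeasurableSpace V] {X : E → Ω → V}
  {P : Measure Ω} [IsProbabilityMeasure P]

theorem measurable_comp_pathShift_path (hX : Measurable fun p : E × Ω => X p.1 p.2) {g : (E → V) → ℝ}
    (hg : Measurable g) :
    Measurable fun p : (E × Ω) × E => g (pathShift p.2 (pathShift p.1.1 fun t => X t p.1.2)) := by
  simp_rw [← pathShift_add]
  exact hg.comp ((measurable_pathShift_path hX).comp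
    ((measurable_snd.add (measurable_fst.comp measurable_fst)).prodMk
      (measurable_snd.comp measurable_fst)))

/-- The average of a functional of the shifted path is, almost surely and simultaneously for two
shifts of the path, a measurable functional of the path. -/
theorem exists_measurable_average_eq (hX : Measurable fun p : E × Ω => X p.1 p.2)
    {g : (E → V) → ℝ} (hg : Measurable g) {C : ℝ} (hC : ∀ x, |g x| ≤ C)
    (ν : Measure E) [IsProbabilityMeasure ν] (τ : E) :
    ∃ G : (E → V) → ℝ, Measurable G ∧ ∀ᵐ ω ∂P,
      ∫ s, g (pathShift s fun t => X t ω) ∂ν = G (fun t => X t ω) ∧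
      ∫ s, g (pathShift s (pathShift τ fun t => X t ω)) ∂ν = G (pathShift τ fun t => X t ω) := by
  have hZ : Measurable fun p : E × Ω => g (pathShift p.1 fun t => X t p.2) :=
    hg.comp (measurable_pathShift_path hX)
  have hZ' : Measurable fun p : E × Ω => g (pathShift p.1 (pathShift τ fun t => X t p.2)) :=
    (measurable_comp_pathShift_path hX hg).comp
      ((measurable_const.prodMk measurable_snd).prodMk measurable_fst)
  obtain ⟨u, hu⟩ := exists_seq_tendsto_sample_mean (P := P) ν hZ hZ' (fun p => hC _) fun p => hC _
  -- Joint measurability of the shift is known only along paths of `X`, not on all of `E → V`. A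
  -- limsup over countably many shifts is measurable on the whole path space.
  refine ⟨fun x => limsup (fun n : ℕ => (∑ i ∈ Finset.range n, g (pathShift (u i) x)) / n) atTop,
    ?_, ?_⟩
  · exact Measurable.limsup fun n => (Finset.measurable_fun_sum _ fun i _ =>
      hg.comp (measurable_pathShift (u i))).div_const _
  · filter_upwards [hu] with ω hω
    exact ⟨hω.1.limsup_eq.symm, hω.2.limsup_eq.symm⟩

/-- The averages of a homogeneous field over finitely many measures are jointly stationary. -/
theorem measure_exists_average_ge_shift_eq (hX : Measurable fun p : E × Ω => X p.1 p.2)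
    (hom : IsHomogeneousField X P) {g : (E → V) → ℝ} (hg : Measurable g) {C : ℝ}
    (hC : ∀ x, |g x| ≤ C) (ν : ℕ → Measure E) [∀ n, IsProbabilityMeasure (ν n)] (lam : ℝ) (N : ℕ)
    (τ : E) :
    P {ω | ∃ n ≤ N, lam ≤ ∫ s, g (pathShift s (pathShift τ fun t => X t ω)) ∂ν n}
      = P {ω | ∃ n ≤ N, lam ≤ ∫ s, g (pathShift s fun t => X t ω) ∂ν n} := by
  choose G hG hGae using fun n => exists_measurable_average_eq (P := P) hX hg hC (ν n) τ
  have hall := ae_all_iff.2 hGae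
  let A : Set (E → V) := {x | ∃ n ≤ N, lam ≤ G n x}
  have hA : MeasurableSet A := by
    have : A = ⋃ n, ⋃ (_ : n ≤ N), {x | lam ≤ G n x} := by ext; simp [A]
    rw [this]
    exact .iUnion fun n => .iUnion fun _ => measurableSet_le measurable_const (hG n)
  have h1 : P {ω | ∃ n ≤ N, lam ≤ ∫ s, g (pathShift s (pathShift τ fun t => X t ω)) ∂ν n}
      = fieldLaw X P (pathShift τ ⁻¹' A) := by
    rw [fieldLaw, Measure.map_apply (measurable_path hX) (measurable_pathShift τ hA)]
    refine measure_congr ?_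
    filter_upwards [hall] with ω hω
    refine propext (exists_congr fun n => and_congr_right fun _ => ?_)
    rw [(hω n).2]
  have h2 : P {ω | ∃ n ≤ N, lam ≤ ∫ s, g (pathShift s fun t => X t ω) ∂ν n}
      = fieldLaw X P A := by
    rw [fieldLaw, Measure.map_apply (measurable_path hX) hA]
    refine measure_congr ?_
    filter_upwards [hall] with ω hω
    refine propext (exists_congr fun n => and_congr_right fun _ => ?_)
    rw [(hω n).1]
  rw [h1, h2, (hom.measurePreserving hX τ).measure_preimage hA.nullMeasurableSet]

end Averages

/-! ### Maximal and pointwise ergodic theorems. -/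

section Ergodic

variable {E : Type*} [NormedAddCommGroup E] [NormedSpace ℝ E] [MeasurableSpace E] [BorelSpace E]
  [FiniteDimensional ℝ E] {Ω : Type*} [MeasurableSpace Ω] {V : Type*} [MeasurableSpace V]
  {X : E → Ω → V} {P : Measure Ω} [IsProbabilityMeasure P]

/-- The maximal ergodic inequality for averages over increasing convex sets. -/
theorem maximal_ergodic_inequality (μ : Measure E) [μ.IsAddHaarMeasure] {T : ℕ → Set E}
    (hmono : Monotone T) (hconv : ∀ n, Convex ℝ (T n)) (hopen : ∀ n, IsOpen (T n))
    (hne : ∀ n, (T n).Nonempty) (hfin : ∀ n, μ (T n) ≠ ∞)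
    (hX : Measurable fun p : E × Ω => X p.1 p.2) (hom : IsHomogeneousField X P)
    {g : (E → V) → ℝ} (hg : Measurable g) (hg0 : ∀ x, 0 ≤ g x) {C : ℝ} (hC : ∀ x, |g x| ≤ C)
    (lam : ℝ) (N : ℕ) :
    ENNReal.ofReal lam * P {ω | ∃ n ≤ N, lam ≤ ∫ s, g (pathShift s fun t => X t ω) ∂μ[|T n]}
      ≤ 8 ^ Module.finrank ℝ E * ∫⁻ x, ENNReal.ofReal (g x) ∂fieldLaw X P := by
  set d := Module.finrank ℝ E
  have hpos : ∀ n, μ (T n) ≠ 0 := fun n => ((hopen n).measure_pos μ (hne n)).ne'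
  have hprob : ∀ n, IsProbabilityMeasure μ[|T n] := fun n =>
    cond_isProbabilityMeasure_of_finite (hpos n) (hfin n)
  set p := P {ω | ∃ n ≤ N, lam ≤ ∫ s, g (pathShift s fun t => X t ω) ∂μ[|T n]} with hp
  -- Transference: by stationarity every section at fixed `t` has probability `p`, while sections at
  -- fixed `ω` obey the weak type inequality on `E`. Fubini over `T N × Ω` compares the two.
  let Bad : Set (E × Ω) :=
    {q | ∃ n ≤ N, lam ≤ ∫ s, g (pathShift s (pathShift q.1 fun t => X t q.2)) ∂μ[|T n]}
  have hBad : MeasurableSet Bad := by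
    have : Bad = ⋃ n, ⋃ (_ : n ≤ N),
      {q | lam ≤ ∫ s, g (pathShift s (pathShift q.1 fun t => X t q.2)) ∂μ[|T n]} := by
      ext; simp [Bad]
    rw [this]
    refine .iUnion fun n => .iUnion fun _ => measurableSet_le measurable_const ?_
    exact (measurable_comp_pathShift_path hX hg).stronglyMeasurable.integral_prod_right'.measurable
  let φ : Ω → E → ℝ≥0∞ := fun ω t => ENNReal.ofReal (g (pathShift t fun t => X t ω))
  have hφ : Measurable fun q : E × Ω => φ q.2 q.1 :=
    (hg.comp (measurable_pathShift_path hX)).ennreal_ofReal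
  have hsec : ∀ ω, Measurable fun s => g (pathShift s fun t => X t ω) := fun ω =>
    hg.comp ((measurable_pathShift_path hX).comp (measurable_id.prodMk measurable_const))
  have hprod1 : ((μ.restrict (T N)).prod P) Bad = p * μ (T N) := by
    rw [Measure.prod_apply hBad]
    have : ∀ t, P (Prod.mk t ⁻¹' Bad) = p := fun t =>
      measure_exists_average_ge_shift_eq hX hom hg hC (fun n => μ[|T n]) lam N t
    simp_rw [this]
    simp
  have hsub : ∀ ω, ENNReal.ofReal lam * μ.restrict (T N) ((fun t => (t, ω)) ⁻¹' Bad)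
      ≤ 4 ^ d * ∫⁻ x in T N + T N, φ ω x ∂μ := by
    intro ω
    refine le_trans ?_ (maximal_weak_type μ hmono hconv hopen hne hfin N (T N) (φ ω)
      (ENNReal.ofReal lam))
    have hBω : MeasurableSet ((fun t => (t, ω)) ⁻¹' Bad) :=
      (measurable_id.prodMk measurable_const) hBad
    rw [Measure.restrict_apply hBω]
    refine mul_le_mul_right (measure_mono ?_) _
    rintro t ⟨⟨n, hn, hle⟩, htN⟩
    refine ⟨htN, n, hn, ?_⟩
    have hle' := ENNReal.ofReal_le_ofReal hle
    simp only [← pathShift_add] at hle'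
    rw [ofReal_integral_eq_lintegral_ofReal] at hle'
    · rw [ProbabilityTheory.cond, lintegral_smul_measure, smul_eq_mul,
        ← ENNReal.mul_le_iff_le_inv (hpos n) (hfin n), mul_comm] at hle'
      simpa only [φ, add_comm t] using hle'
    · refine Integrable.of_bound ?_ C (Eventually.of_forall fun s => hC _)
      exact ((hsec ω).comp (measurable_id.add_const t)).aestronglyMeasurable
    · exact Eventually.of_forall fun s => hg0 _
  have hmean : ∀ x, ∫⁻ ω, φ ω x ∂P = ∫⁻ x, ENNReal.ofReal (g x) ∂fieldLaw X P := by
    intro t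
    rw [← (hom.measurePreserving hX t).lintegral_comp hg.ennreal_ofReal, fieldLaw,
      lintegral_map (f := fun x => ENNReal.ofReal (g (pathShift t x)))
        (hg.comp (measurable_pathShift t)).ennreal_ofReal (measurable_path hX)]
  -- By convexity `T N + T N = 2 • T N`; this `2 ^ d` and the doubling constant `4 ^ d` make the
  -- final `8 ^ d`.
  have hTT : μ (T N + T N) = 2 ^ d * μ (T N) := by
    have : T N + T N = (2 : ℝ) • T N := by
      rw [← one_add_one_eq_two, (hconv N).add_smul zero_le_one zero_le_one, one_smul]
    rw [this, Measure.addHaar_smul, abs_of_nonneg (by positivity),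
      ENNReal.ofReal_pow (by norm_num)]
    simp
    rfl
  refine (ENNReal.mul_le_mul_iff_left (hpos N) (hfin N)).1 ?_
  calc ENNReal.ofReal lam * p * μ (T N)
      = ENNReal.ofReal lam * ∫⁻ ω, μ.restrict (T N) ((fun t => (t, ω)) ⁻¹' Bad) ∂P := by
        rw [mul_assoc, ← hprod1, Measure.prod_apply_symm hBad]
    _ = ∫⁻ ω, ENNReal.ofReal lam * μ.restrict (T N) ((fun t => (t, ω)) ⁻¹' Bad) ∂P := by
        rw [lintegral_const_mul _ (measurable_measure_prodMk_right hBad)]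
    _ ≤ ∫⁻ ω, 4 ^ d * ∫⁻ x in T N + T N, φ ω x ∂μ ∂P := lintegral_mono hsub
    _ = 4 ^ d * ∫⁻ x in T N + T N, ∫⁻ ω, φ ω x ∂P ∂μ := by
        rw [lintegral_const_mul _ hφ.lintegral_prod_left', lintegral_lintegral_swap]
        exact (hφ.comp measurable_swap).aemeasurable
    _ = 8 ^ d * (∫⁻ x, ENNReal.ofReal (g x) ∂fieldLaw X P) * μ (T N) := by
        simp_rw [hmean]
        rw [setLIntegral_const, hTT, show (8 : ℝ≥0∞) = 4 * 2 by norm_num, mul_pow]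
        ring

/-- The average of `W - W ∘ pathShift h` compares averages of `W` over `T n` and its translate by
`h`, which differ little once `T n` contains a large ball. Measurability and boundedness ride along
in the induction because additivity of the integral needs them. -/
theorem tendsto_average_boundedCoboundaries (μ : Measure E) [μ.IsAddHaarMeasure] {T : ℕ → Set E}
    (hconv : ∀ n, Convex ℝ (T n)) (hopen : ∀ n, IsOpen (T n))
    (hne : ∀ n, (T n).Nonempty) (hfin : ∀ n, μ (T n) ≠ ∞) {c : ℕ → E} {r : ℕ → ℝ}
    (hr : Tendsto r atTop atTop) (hball : ∀ n, Metric.ball (c n) (r n) ⊆ T n)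
    {k : (E → V) → ℝ} (hk : k ∈ boundedCoboundaries (pathShift : E → (E → V) → E → V))
    {x : E → V} (hx : Measurable fun s => pathShift s x) :
    Measurable k ∧ (∃ C, ∀ y, |k y| ≤ C) ∧
      Tendsto (fun n => ∫ s, k (pathShift s x) ∂μ[|T n]) atTop (𝓝 0) := by
  have hpos : ∀ n, μ (T n) ≠ 0 := fun n => ((hopen n).measure_pos μ (hne n)).ne'
  have hprob : ∀ n, IsProbabilityMeasure μ[|T n] := fun n =>
    cond_isProbabilityMeasure_of_finite (hpos n) (hfin n)
  have hint : ∀ f : (E → V) → ℝ, Measurable f → (∃ C, ∀ y, |f y| ≤ C) → ∀ n,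
      Integrable (fun s => f (pathShift s x)) μ[|T n] := fun f hf ⟨C, hC⟩ n =>
    Integrable.of_bound (hf.comp hx).aestronglyMeasurable C (Eventually.of_forall fun s => hC _)
  induction hk using Submodule.span_induction with
  | mem k hk =>
    obtain ⟨h, W, hW, ⟨C, hC⟩, rfl⟩ := hk
    refine ⟨hW.sub (hW.comp (measurable_pathShift h)), ⟨C + C, fun x =>
      (abs_sub _ _).trans (add_le_add (hC _) (hC _))⟩, ?_⟩
    have hlim : Tendsto (fun n => 2 * C * ((1 + (‖h‖ + 1) / r n) ^ Module.finrank ℝ E - 1)) atTop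
        (𝓝 0) := by
      have h1 : Tendsto (fun n => (‖h‖ + 1) / r n) atTop (𝓝 0) := hr.const_div_atTop _
      have h2 := (((h1.const_add 1).pow (Module.finrank ℝ E)).sub_const 1).const_mul (2 * C)
      simpa using h2
    refine squeeze_zero_norm' ?_ hlim
    filter_upwards [hr.eventually_gt_atTop 0] with n hn
    have hshift : ∫ s, W (pathShift (h + s) x) ∂μ[|T n]
        = ∫ s, W (pathShift h (pathShift s x)) ∂μ[|T n] := by simp_rw [pathShift_add]
    have h1 := abs_average_add_sub_average_le μ (hconv n) (hopen n).measurableSet (hpos n) (hfin n)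
      hn (hball n) (hW.comp hx) (fun s => hC _) h
    simp only [Function.comp_def] at h1
    rw [hshift] at h1
    rw [integral_sub (hint W hW ⟨C, hC⟩ n)
      (hint (fun y => W (pathShift h y)) (hW.comp (measurable_pathShift h)) ⟨C, fun y => hC _⟩ n),
      Real.norm_eq_abs, abs_sub_comm]
    exact h1
  | zero => exact ⟨measurable_zero, ⟨0, by simp⟩, by simp⟩
  | add f f' _ _ hf hf' =>
    obtain ⟨hf, ⟨C, hC⟩, hlim⟩ := hf
    obtain ⟨hf', ⟨D, hD⟩, hlim'⟩ := hf'
    refine ⟨hf.add hf', ⟨C + D, fun x => (abs_add_le _ _).trans (add_le_add (hC x) (hD x))⟩, ?_⟩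
    simp only [Pi.add_apply]
    simp_rw [integral_add (hint f hf ⟨C, hC⟩ _) (hint f' hf' ⟨D, hD⟩ _)]
    simpa using hlim.add hlim'
  | smul a f _ hf =>
    obtain ⟨hf, ⟨C, hC⟩, hlim⟩ := hf
    refine ⟨hf.const_smul a, ⟨|a| * C, fun x => ?_⟩, ?_⟩
    · rw [Pi.smul_apply, smul_eq_mul, abs_mul]
      gcongr
      exact hC x
    · simp only [Pi.smul_apply, smul_eq_mul, integral_const_mul]
      simpa using hlim.const_mul a

/-- The pointwise ergodic theorem for averages of a homogeneous ergodic random field over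
increasing convex sets. -/
theorem ae_tendsto_average (μ : Measure E) [μ.IsAddHaarMeasure] {T : ℕ → Set E}
    (hmono : Monotone T) (hconv : ∀ n, Convex ℝ (T n)) (hopen : ∀ n, IsOpen (T n))
    (hne : ∀ n, (T n).Nonempty) (hfin : ∀ n, μ (T n) ≠ ∞) {c : ℕ → E} {r : ℕ → ℝ}
    (hr : Tendsto r atTop atTop) (hball : ∀ n, Metric.ball (c n) (r n) ⊆ T n)
    (hX : Measurable fun p : E × Ω => X p.1 p.2) (hom : IsHomogeneousField X P)
    (herg : IsErgodicField X P) {g : (E → V) → ℝ} (hg : Measurable g) {C : ℝ}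
    (hC : ∀ x, |g x| ≤ C) :
    ∀ᵐ ω ∂P, Tendsto (fun n => ∫ s, g (pathShift s fun t => X t ω) ∂μ[|T n]) atTop
      (𝓝 (∫ x, g x ∂fieldLaw X P)) := by
  have := isProbabilityMeasure_fieldLaw (P := P) hX
  set d := Module.finrank ℝ E
  set a := ∫ x, g x ∂fieldLaw X P
  have hpos : ∀ n, μ (T n) ≠ 0 := fun n => ((hopen n).measure_pos μ (hne n)).ne'
  have hprob : ∀ n, IsProbabilityMeasure μ[|T n] := fun n =>
    cond_isProbabilityMeasure_of_finite (hpos n) (hfin n)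
  -- One `lam` absorbs the coboundary part, eventually in `n`; the other bounds the error part. If
  -- the exceptional set had measure `b ≠ 0`, an error of L¹ norm below `lam * b / 8 ^ d` would
  -- contradict the maximal inequality.
  have main : ∀ lam : ℝ, 0 < lam → ∀ᵐ ω ∂P, ∀ᶠ n in atTop,
      |∫ s, g (pathShift s fun t => X t ω) ∂μ[|T n] - a| ≤ 2 * lam := by
    intro lam hlam
    by_contra hcon
    set b := P {ω | ¬ ∀ᶠ n in atTop,
      |∫ s, g (pathShift s fun t => X t ω) ∂μ[|T n] - a| ≤ 2 * lam}
    have hb : b ≠ 0 := hcon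
    have h8 : (8 : ℝ≥0∞) ^ d ≠ 0 := by positivity
    have h8' : (8 : ℝ≥0∞) ^ d ≠ ∞ := ENNReal.pow_ne_top (by norm_num)
    obtain ⟨k, hk, hlt⟩ := exists_boundedCoboundaries_approx (fun h => hom.measurePreserving hX h)
      herg hg hC (ε := ENNReal.ofReal lam * b / 8 ^ d)
      (ENNReal.div_ne_zero.2 ⟨mul_ne_zero (by simpa using hlam) hb, h8'⟩)
    obtain ⟨hkm, D, hD⟩ := measurable_and_bounded_of_mem_boundedCoboundaries
      (fun h => hom.measurePreserving hX h) hk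
    let e : (E → V) → ℝ := fun x => g x - a - k x
    have he : Measurable e := (hg.sub_const a).sub hkm
    have heC : ∀ x, |e x| ≤ C + |a| + D := fun x =>
      (abs_sub _ _).trans (add_le_add ((abs_sub _ _).trans (by gcongr; exact hC x)) (hD x))
    have hmax := fun N => maximal_ergodic_inequality μ hmono hconv hopen hne hfin hX hom
      (g := fun x => |e x|) he.abs (fun x => abs_nonneg _) (C := C + |a| + D)
      (fun x => by rw [abs_abs]; exact heC x) lam N
    have hle : b ≤ ⨆ N : ℕ,
        P {ω | ∃ n ≤ N, lam ≤ ∫ s, |e (pathShift s fun t => X t ω)| ∂μ[|T n]} := by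
      have hmonoN : Monotone fun N : ℕ =>
          {ω | ∃ n ≤ N, lam ≤ ∫ s, |e (pathShift s fun t => X t ω)| ∂μ[|T n]} :=
        fun N N' hN ω ⟨n, hn, h⟩ => ⟨n, hn.trans hN, h⟩
      rw [← hmonoN.measure_iUnion]
      refine measure_mono fun ω hω => ?_
      by_contra hnot
      simp only [Set.mem_iUnion, Set.mem_ofPred_eq, not_exists, not_and, not_le] at hnot
      refine hω ?_
      have hpath : Measurable fun s => pathShift s fun t => X t ω :=
        (measurable_pathShift_path hX).comp (measurable_id.prodMk measurable_const)
      obtain ⟨-, -, hlim⟩ := tendsto_average_boundedCoboundaries μ hconv hopen hne hfin hr hball hk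
        hpath
      filter_upwards [hlim.norm.eventually_lt_const (show ‖(0 : ℝ)‖ < lam by simpa using hlam)]
        with n hn
      have hint : ∀ f : (E → V) → ℝ, Measurable f → ∀ D, (∀ y, |f y| ≤ D) →
          Integrable (fun s => f (pathShift s fun t => X t ω)) μ[|T n] := fun f hf D hD =>
        Integrable.of_bound (hf.comp hpath).aestronglyMeasurable D
          (Eventually.of_forall fun s => hD _)
      have hsum : ∫ s, g (pathShift s fun t => X t ω) ∂μ[|T n] - a
          = ∫ s, k (pathShift s fun t => X t ω) ∂μ[|T n]
            + ∫ s, e (pathShift s fun t => X t ω) ∂μ[|T n] := by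
        rw [← integral_add (hint k hkm D hD) (hint e he _ heC)]
        have h1 : ∀ s : E, k (pathShift s fun t => X t ω) + e (pathShift s fun t => X t ω)
            = g (pathShift s fun t => X t ω) - a := fun s => by simp only [e]; ring
        simp_rw [h1]
        rw [integral_sub (hint g hg C hC) (integrable_const _)]
        simp
      rw [hsum]
      have h2 : |∫ s, e (pathShift s fun t => X t ω) ∂μ[|T n]| ≤ lam :=
        abs_integral_le_integral_abs.trans (hnot n n le_rfl).le
      rw [Real.norm_eq_abs] at hn
      exact (abs_add_le _ _).trans (by linarith)
    have hfinal : ENNReal.ofReal lam * b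
        ≤ 8 ^ d * ∫⁻ x, ENNReal.ofReal |e x| ∂fieldLaw X P := by
      refine (mul_le_mul_right hle _).trans ?_
      rw [ENNReal.mul_iSup]
      exact iSup_le hmax
    have hlt' : (8 : ℝ≥0∞) ^ d * ∫⁻ x, ENNReal.ofReal |e x| ∂fieldLaw X P
        < ENNReal.ofReal lam * b := by
      have h3 : ∫⁻ x, ENNReal.ofReal |e x| ∂fieldLaw X P
          = ∫⁻ x, ‖g x - a - k x‖ₑ ∂fieldLaw X P := by
        simp_rw [Real.enorm_eq_ofReal_abs]; rfl
      rw [h3, mul_comm]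
      exact (ENNReal.lt_div_iff_mul_lt (Or.inl h8) (Or.inl h8')).1 hlt
    exact absurd hfinal (not_le.2 hlt')
  have hall := ae_all_iff.2 fun j : ℕ => main (1 / ((j : ℝ) + 1)) (by positivity)
  filter_upwards [hall] with ω hω
  rw [Metric.tendsto_atTop']
  intro ε hε
  obtain ⟨j, hj⟩ := exists_nat_one_div_lt (show 0 < ε / 2 by positivity)
  obtain ⟨N, hN⟩ := eventually_atTop.1 (hω j)
  refine ⟨N, fun n hn => ?_⟩
  rw [Real.dist_eq]
  exact (hN n hn.le).trans_lt (by linarith)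

end Ergodic

/-! ### Concentration of sample means, row by row. -/

section RandomSampling

variable {E : Type*} [MeasurableSpace E] {Ω' : Type*} [MeasurableSpace Ω'] {Q : Measure Ω'}
  [IsProbabilityMeasure Q]

/-- One-sided Hoeffding bound for a sum of independent centred variables with range of length
one. -/
theorem measure_sum_sub_integral_ge_le {k : ℕ} {Y : Fin k → Ω' → ℝ} (hY : ∀ i, Measurable (Y i))
    (hind : iIndepFun Y Q) {a : ℝ} (hmem : ∀ i ω, Y i ω ∈ Set.Icc a (a + 1)) {c : ℝ}
    (hc : ∀ i, ∫ ω, Y i ω ∂Q = c) {ε : ℝ} (hε : 0 ≤ ε) :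
    Q.real {ω | k * ε ≤ ∑ i, (Y i ω - c)} ≤ Real.exp (-2 * k * ε ^ 2) := by
  rcases Nat.eq_zero_or_pos k with rfl | hk
  · simp
  -- Hoeffding's lemma: the variance proxy is the square of half the range.
  have hsub : ∀ i ∈ Finset.univ, HasSubgaussianMGF (fun ω => Y i ω - c) ((2⁻¹ : ℝ≥0) ^ 2) Q := by
    intro i _
    have h := hasSubgaussianMGF_of_mem_Icc (hY i).aemeasurable
      (Eventually.of_forall (f := ae Q) fun ω => hmem i ω)
    rw [hc i] at h
    simpa using h
  have hind' : iIndepFun (fun i ω => Y i ω - c) Q :=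
    hind.comp (fun _ y => y - c) fun _ => measurable_id.sub_const c
  refine (HasSubgaussianMGF.measure_sum_ge_le_of_iIndepFun hind' hsub
    (show (0 : ℝ) ≤ k * ε by positivity)).trans_eq ?_
  congr 1
  have : (k : ℝ) ≠ 0 := by positivity
  simp
  field_simp

/-- Hoeffding's inequality for the sample mean of a function with values in the unit interval. -/
theorem measure_abs_sample_mean_sub_ge_le {k : ℕ} {ξ : Fin k → Ω' → E} {ν : Measure E}
    (hξ : ∀ i, Measurable (ξ i)) (hlaw : ∀ i, Q.map (ξ i) = ν) (hind : iIndepFun ξ Q) {f : E → ℝ}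
    (hf : Measurable f) (hf01 : ∀ x, f x ∈ Set.Icc (0 : ℝ) 1) {ε : ℝ} (hε : 0 ≤ ε) :
    Q.real {ω | ε ≤ |(∑ i, f (ξ i ω)) / k - ∫ s, f s ∂ν|} ≤ 2 * Real.exp (-2 * k * ε ^ 2) := by
  rcases Nat.eq_zero_or_pos k with rfl | hk
  · refine measureReal_le_one.trans ?_
    simp
  have hk' : (0 : ℝ) < k := by exact_mod_cast hk
  set c := ∫ s, f s ∂ν
  have hint : ∀ i, ∫ ω, f (ξ i ω) ∂Q = c := fun i => by
    rw [← integral_map (hξ i).aemeasurable hf.aestronglyMeasurable, hlaw i]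
  have h1 := measure_sum_sub_integral_ge_le (Q := Q) (a := 0) (fun i => hf.comp (hξ i))
    (hind.comp (fun _ => f) fun _ => hf) (fun i ω => by simpa using hf01 (ξ i ω)) hint hε
  have h2 := measure_sum_sub_integral_ge_le (Q := Q) (a := -1) (Y := fun i ω => -f (ξ i ω))
    (c := -c) (fun i => (hf.comp (hξ i)).neg)
    (hind.comp (fun _ x => -f x) fun _ => hf.neg)
    (fun i ω => by have := hf01 (ξ i ω); constructor <;> linarith [this.1, this.2])
    (fun i => by rw [integral_neg, hint i]) hε
  have hsub : {ω | ε ≤ |(∑ i, f (ξ i ω)) / k - c|} ⊆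
      {ω | k * ε ≤ ∑ i, (f (ξ i ω) - c)} ∪ {ω | k * ε ≤ ∑ i, (-f (ξ i ω) - -c)} := by
    intro ω hω
    have hω : ε ≤ |(∑ i, f (ξ i ω)) / k - c| := hω
    have e : (∑ i, f (ξ i ω)) / k - c = (∑ i, (f (ξ i ω) - c)) / k := by
      simp
      field_simp
    have e' : ∑ i, (-f (ξ i ω) - -c) = -∑ i, (f (ξ i ω) - c) := by
      rw [← Finset.sum_neg_distrib]
      exact Finset.sum_congr rfl fun i _ => by ring
    rw [e, abs_div, abs_of_pos hk', le_div_iff₀ hk', le_abs, mul_comm] at hω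
    rcases hω with h | h
    · exact Or.inl h
    · right
      change k * ε ≤ ∑ i, (-f (ξ i ω) - -c)
      rwa [e']
  calc _ ≤ _ := measureReal_mono hsub
    _ ≤ _ := measureReal_union_le _ _
    _ ≤ _ := by rw [two_mul]; exact add_le_add h1 h2

/-- Strong law for the rows of a triangular array; nothing is assumed on the joint law of
different rows. -/
theorem ae_tendsto_sample_mean_sub {k : ℕ → ℕ} (hk : StrictMono k)
    {ξ : (n : ℕ) → Fin (k n) → Ω' → E} {ν : ℕ → Measure E} (hξ : ∀ n i, Measurable (ξ n i))
    (hlaw : ∀ n i, Q.map (ξ n i) = ν n) (hind : ∀ n, iIndepFun (ξ n) Q) {f : E → ℝ}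
    (hf : Measurable f) (hf01 : ∀ x, f x ∈ Set.Icc (0 : ℝ) 1) :
    ∀ᵐ ω ∂Q, Tendsto (fun n => (∑ i, f (ξ n i ω)) / k n - ∫ s, f s ∂ν n) atTop (𝓝 0) := by
  have main : ∀ ε : ℝ, 0 < ε → ∀ᵐ ω ∂Q, ∀ᶠ n in atTop,
      ω ∉ {ω | ε ≤ |(∑ i, f (ξ n i ω)) / k n - ∫ s, f s ∂ν n|} := by
    intro ε hε
    refine ae_eventually_notMem ?_
    have hbound : ∀ n, Q {ω | ε ≤ |(∑ i, f (ξ n i ω)) / k n - ∫ s, f s ∂ν n|}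
        ≤ ENNReal.ofReal (2 * Real.exp (n * (-2 * ε ^ 2))) := by
      intro n
      rw [← ofReal_measureReal]
      refine ENNReal.ofReal_le_ofReal
        ((measure_abs_sample_mean_sub_ge_le (hξ n) (hlaw n) (hind n) hf hf01 hε.le).trans ?_)
      -- Strict growth gives `n ≤ k n`, so the Hoeffding bounds are dominated by a convergent
      -- geometric series, as Borel–Cantelli requires.
      have h1 : (n : ℝ) ≤ k n := by exact_mod_cast hk.le_apply
      gcongr 2 * Real.exp ?_
      nlinarith [sq_nonneg ε]
    have hsum : Summable fun n : ℕ => 2 * Real.exp (n * (-2 * ε ^ 2)) :=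
      (Real.summable_exp_nat_mul_iff.2 (by nlinarith [pow_pos hε 2])).mul_left 2
    exact ((ENNReal.tsum_le_tsum hbound).trans_lt hsum.tsum_ofReal_lt_top).ne
  filter_upwards [ae_all_iff.2 fun j : ℕ => main (1 / ((j : ℝ) + 1)) (by positivity)] with ω hω
  refine Metric.tendsto_atTop.2 fun ε hε => ?_
  obtain ⟨j, hj⟩ := exists_nat_one_div_lt hε
  obtain ⟨N, hN⟩ := eventually_atTop.1 (hω j)
  refine ⟨N, fun n hn => ?_⟩
  rw [Real.dist_eq, sub_zero]
  exact (not_le.1 (hN n hn)).trans hj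

end RandomSampling

/-! ### Finite brackets and uniform convergence. -/

section GlivenkoCantelli

/-- The intervals `(u n, a)` with `u n` increasing to `a` shrink to the empty set, so continuity
from above applies; a possible atom at `a` is excluded. -/
theorem exists_measure_Ioo_lt_of_lt {α : Type*} [LinearOrder α] [TopologicalSpace α]
    [OrderTopology α] [DenselyOrdered α] [FirstCountableTopology α] [MeasurableSpace α]
    [OpensMeasurableSpace α] (σ : Measure α) [IsFiniteMeasure σ] {ε : ℝ≥0∞} (hε : 0 < ε) {a y : α}
    (hy : y < a) : ∃ b < a, σ (Set.Ioo b a) < ε := by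
  obtain ⟨u, hu, hua, hlim⟩ := exists_seq_strictMono_tendsto' hy
  have hinter : ⋂ n, Set.Ioo (u n) a = ∅ := by
    refine Set.eq_empty_of_forall_notMem fun x hx => ?_
    rw [Set.mem_iInter] at hx
    exact absurd (le_of_tendsto' hlim fun n => (hx n).1.le) (not_le.2 (hx 0).2)
  have h := tendsto_measure_iInter_atTop (μ := σ) (s := fun n => Set.Ioo (u n) a)
    (fun n => measurableSet_Ioo.nullMeasurableSet)
    (fun n m h => Set.Ioo_subset_Ioo_left (hu.monotone h)) ⟨0, measure_ne_top _ _⟩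
  rw [hinter, measure_empty] at h
  obtain ⟨n, hn⟩ := (h.eventually_lt_const hε).exists
  exact ⟨u n, (hua n).2, hn⟩

theorem exists_measure_Ioo_lt_of_gt {α : Type*} [LinearOrder α] [TopologicalSpace α]
    [OrderTopology α] [DenselyOrdered α] [FirstCountableTopology α] [MeasurableSpace α]
    [OpensMeasurableSpace α] (σ : Measure α) [IsFiniteMeasure σ] {ε : ℝ≥0∞} (hε : 0 < ε) {a y : α}
    (hy : a < y) : ∃ b > a, σ (Set.Ioo a b) < ε := by
  obtain ⟨u, hu, hua, hlim⟩ := exists_seq_strictAnti_tendsto' hy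
  have hinter : ⋂ n, Set.Ioo a (u n) = ∅ := by
    refine Set.eq_empty_of_forall_notMem fun x hx => ?_
    rw [Set.mem_iInter] at hx
    exact absurd (ge_of_tendsto' hlim fun n => (hx n).2.le) (not_le.2 (hx 0).1)
  have h := tendsto_measure_iInter_atTop (μ := σ) (s := fun n => Set.Ioo a (u n))
    (fun n => measurableSet_Ioo.nullMeasurableSet)
    (fun n m h => Set.Ioo_subset_Ioo_right (hu.antitone h)) ⟨0, measure_ne_top _ _⟩
  rw [hinter, measure_empty] at h
  obtain ⟨n, hn⟩ := (h.eventually_lt_const hε).exists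
  exact ⟨u n, (hua n).1, hn⟩

/-- Finite bracketing of the half-lines with respect to a finite measure. -/
theorem exists_finite_brackets_Iic (ρ : Measure ℝ) [IsFiniteMeasure ρ] {ε : ℝ≥0∞} (hε : 0 < ε) :
    ∃ 𝓑 : Set (Set ℝ × Set ℝ), 𝓑.Finite ∧
      (∀ B ∈ 𝓑, MeasurableSet B.1 ∧ MeasurableSet B.2 ∧ ρ (B.2 \ B.1) ≤ ε) ∧
      ∀ x, ∃ B ∈ 𝓑, B.1 ⊆ Set.Iic x ∧ Set.Iic x ⊆ B.2 := by
  -- `p s` says that finitely many brackets serve all real thresholds in `s`. It passes to subsets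
  -- and finite unions and holds locally, hence on the compact space `EReal`. Each point is split
  -- into a left interval, a singleton and a right interval, so atoms cost nothing.
  let p : Set EReal → Prop := fun s => ∃ 𝓑 : Set (Set ℝ × Set ℝ), 𝓑.Finite ∧
    (∀ B ∈ 𝓑, MeasurableSet B.1 ∧ MeasurableSet B.2 ∧ ρ (B.2 \ B.1) ≤ ε) ∧
    ∀ x : ℝ, (x : EReal) ∈ s → ∃ B ∈ 𝓑, B.1 ⊆ Set.Iic x ∧ Set.Iic x ⊆ B.2
  have hcoe : Measurable ((↑) : ℝ → EReal) := measurable_coe_real_ereal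
  have hempty : p ∅ := ⟨∅, Set.finite_empty, by simp, by simp⟩
  have hmono : ∀ ⦃s t : Set EReal⦄, s ⊆ t → p t → p s := fun s t hst ⟨𝓑, h1, h2, h3⟩ =>
    ⟨𝓑, h1, h2, fun x hx => h3 x (hst hx)⟩
  have hunion : ∀ ⦃s t : Set EReal⦄, p s → p t → p (s ∪ t) := by
    rintro s t ⟨𝓑, h1, h2, h3⟩ ⟨𝓑', h1', h2', h3'⟩
    refine ⟨𝓑 ∪ 𝓑', h1.union h1', fun B hB => hB.elim (h2 B) (h2' B), fun x hx => ?_⟩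
    rcases hx with hx | hx
    · obtain ⟨B, hB, h⟩ := h3 x hx
      exact ⟨B, Or.inl hB, h⟩
    · obtain ⟨B, hB, h⟩ := h3' x hx
      exact ⟨B, Or.inr hB, h⟩
  have hIoo : ∀ b c : EReal, ρ.map (↑) (Set.Ioo b c) < ε → p (Set.Ioo b c) := by
    intro b c h
    rw [Measure.map_apply hcoe measurableSet_Ioo] at h
    -- The gap of this bracket is exactly the open interval `(b, c)`.
    refine ⟨{((↑) ⁻¹' Set.Iic b, (↑) ⁻¹' Set.Iio c)}, Set.finite_singleton _, ?_, fun x hx => ?_⟩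
    · rintro _ rfl
      refine ⟨hcoe measurableSet_Iic, hcoe measurableSet_Iio, le_trans (measure_mono ?_) h.le⟩
      exact fun x hx => ⟨not_le.1 hx.2, hx.1⟩
    · refine ⟨_, rfl, fun y hy => ?_, fun y hy => ?_⟩
      · exact EReal.coe_le_coe_iff.1 (le_trans hy hx.1.le)
      · exact lt_of_le_of_lt (EReal.coe_le_coe_iff.2 hy) hx.2
  have hsingle : ∀ a : EReal, p {a} := by
    intro a
    refine ⟨{((↑) ⁻¹' Set.Iic a, (↑) ⁻¹' Set.Iic a)}, Set.finite_singleton _, ?_, fun x hx => ?_⟩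
    · rintro _ rfl
      exact ⟨hcoe measurableSet_Iic, hcoe measurableSet_Iic, by simp⟩
    · obtain rfl : (x : EReal) = a := hx
      exact ⟨_, rfl, fun y hy => EReal.coe_le_coe_iff.1 hy, fun y hy => EReal.coe_le_coe_iff.2 hy⟩
  have hleft : ∀ a : EReal, ∃ s ∈ 𝓝[<] a, p s := by
    intro a
    rcases eq_bot_or_bot_lt a with rfl | ha
    · exact ⟨∅, by simp, hempty⟩
    · have := Measure.isFiniteMeasure_map ρ ((↑) : ℝ → EReal)
      obtain ⟨b, hb, h⟩ := exists_measure_Ioo_lt_of_lt (ρ.map ((↑) : ℝ → EReal)) hε ha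
      exact ⟨_, Ioo_mem_nhdsLT hb, hIoo b a h⟩
  have hright : ∀ a : EReal, ∃ s ∈ 𝓝[>] a, p s := by
    intro a
    rcases eq_top_or_lt_top a with rfl | ha
    · exact ⟨∅, by simp, hempty⟩
    · have := Measure.isFiniteMeasure_map ρ ((↑) : ℝ → EReal)
      obtain ⟨b, hb, h⟩ := exists_measure_Ioo_lt_of_gt (ρ.map ((↑) : ℝ → EReal)) hε ha
      exact ⟨_, Ioo_mem_nhdsGT hb, hIoo a b h⟩
  obtain ⟨𝓑, h1, h2, h3⟩ : p Set.univ := by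
    refine isCompact_univ.induction_on hempty hmono hunion fun a _ => ?_
    obtain ⟨s, hs, hps⟩ := hleft a
    obtain ⟨t, ht, hpt⟩ := hright a
    refine ⟨(s ∪ {a}) ∪ t, ?_, hunion (hunion hps (hsingle a)) hpt⟩
    rw [nhdsWithin_univ, ← nhdsLE_sup_nhdsGT, ← Set.Iio_insert, nhdsWithin_insert]
    refine ⟨⟨?_, ?_⟩, ?_⟩
    · simp
    · exact mem_of_superset hs fun x hx => Or.inl (Or.inl hx)
    · exact mem_of_superset ht fun x hx => Or.inr hx
  exact ⟨𝓑, h1, h2, fun x => h3 x (Set.mem_univ _)⟩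

/-- Finite bracketing of the lower orthants with respect to a finite measure. -/
theorem exists_finite_brackets_orthant {l : ℕ} (ν : Measure (Fin l → ℝ)) [IsFiniteMeasure ν]
    {ε : ℝ} (hε : 0 < ε) :
    ∃ 𝓑 : Set (Set (Fin l → ℝ) × Set (Fin l → ℝ)), 𝓑.Finite ∧
      (∀ B ∈ 𝓑, MeasurableSet B.1 ∧ MeasurableSet B.2 ∧ ν.real (B.2 \ B.1) ≤ ε) ∧
      ∀ x, ∃ B ∈ 𝓑, B.1 ⊆ Set.Iic x ∧ Set.Iic x ⊆ B.2 := by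
  -- The gap of a product bracket is at most the sum of `l` one-dimensional gaps; `l + 1` avoids
  -- dividing by zero when `l = 0`.
  set δ : ℝ := ε / (l + 1) with hδ
  have hδ0 : 0 < δ := by positivity
  choose 𝓒 hfin hbr hcov using fun j : Fin l =>
    exists_finite_brackets_Iic (ν.map fun v => v j) (ENNReal.ofReal_pos.2 hδ0)
  refine ⟨(fun B : Fin l → Set ℝ × Set ℝ =>
    (Set.univ.pi fun j => (B j).1, Set.univ.pi fun j => (B j).2)) '' Set.univ.pi 𝓒,
    (Set.Finite.pi hfin).image _, ?_, fun x => ?_⟩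
  · rintro _ ⟨B, hB, rfl⟩
    have hB' : ∀ j, B j ∈ 𝓒 j := fun j => hB j (Set.mem_univ j)
    have m1 : ∀ j, MeasurableSet (B j).1 := fun j => (hbr j _ (hB' j)).1
    have m2 : ∀ j, MeasurableSet (B j).2 := fun j => (hbr j _ (hB' j)).2.1
    refine ⟨.univ_pi m1, .univ_pi m2, ?_⟩
    have hsub : (Set.univ.pi fun j => (B j).2) \ (Set.univ.pi fun j => (B j).1)
        ⊆ ⋃ j, (fun v : Fin l → ℝ => v j) ⁻¹' ((B j).2 \ (B j).1) := by
      rintro v ⟨hv2, hv1⟩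
      simp only [Set.mem_pi, Set.mem_univ, true_imp_iff, not_forall] at hv1 hv2
      obtain ⟨j, hj⟩ := hv1
      exact Set.mem_iUnion.2 ⟨j, hv2 j, hj⟩
    calc _ ≤ ν.real (⋃ j, (fun v : Fin l → ℝ => v j) ⁻¹' ((B j).2 \ (B j).1)) :=
          measureReal_mono hsub
      _ ≤ ∑ j, ν.real ((fun v : Fin l → ℝ => v j) ⁻¹' ((B j).2 \ (B j).1)) :=
          measureReal_iUnion_fintype_le _
      _ ≤ ∑ j : Fin l, δ := Finset.sum_le_sum fun j _ => by
          have h := (hbr j _ (hB' j)).2.2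
          rw [Measure.map_apply (measurable_pi_apply j) ((m2 j).diff (m1 j))] at h
          exact ENNReal.toReal_le_of_le_ofReal hδ0.le h
      _ ≤ ε := by
          simp only [Finset.sum_const, Finset.card_univ, Fintype.card_fin, nsmul_eq_mul]
          rw [hδ, ← mul_div_assoc, div_le_iff₀ (by positivity)]
          nlinarith
  · choose B hB hB1 hB2 using fun j => hcov j (x j)
    refine ⟨_, ⟨B, fun j _ => hB j, rfl⟩, fun v hv j => hB1 j (hv j (Set.mem_univ j)),
      fun v hv j _ => hB2 j (hv j)⟩

/-- The relative frequency with which a sample falls into a set. -/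
noncomputable def sampleFreq {S : Type*} {k : ℕ} (v : Fin k → S) (A : Set S) : ℝ :=
  (∑ i, A.indicator (fun _ => (1 : ℝ)) (v i)) / k

theorem sampleFreq_mono {S : Type*} {k : ℕ} (v : Fin k → S) {A B : Set S} (h : A ⊆ B) :
    sampleFreq v A ≤ sampleFreq v B := by
  unfold sampleFreq
  gcongr

theorem empiricalCDF_eq_sampleFreq {l k : ℕ} (v : Fin k → Fin l → ℝ) (x : Fin l → ℝ) :
    empiricalCDF v x = sampleFreq v (Set.Iic x) := by
  classical
  unfold empiricalCDF sampleFreq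
  rw [one_div, inv_mul_eq_div]
  congr 1
  refine Finset.sum_congr rfl fun i _ => ?_
  by_cases h : ∀ j, v i j ≤ x j
  · simp [Set.indicator, Pi.le_def, h]
  · simp [Set.indicator, Pi.le_def, h]

/-- If the relative frequencies of every Borel set converge almost surely to its probability,
then the empirical distribution functions converge uniformly almost surely. -/
theorem ae_tendsto_iSup_abs_empiricalCDF_sub {l : ℕ} {S : Type*} [MeasurableSpace S]
    {θ : Measure S} (ν : Measure (Fin l → ℝ)) [IsFiniteMeasure ν] {k : ℕ → ℕ}
    {v : S → (n : ℕ) → Fin (k n) → Fin l → ℝ}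
    (hv : ∀ A, MeasurableSet A → ∀ᵐ p ∂θ, Tendsto (fun n => sampleFreq (v p n) A) atTop
      (𝓝 (ν.real A))) :
    ∀ᵐ p ∂θ, Tendsto (fun n => ⨆ x, |empiricalCDF (v p n) x - ν.real (Set.Iic x)|) atTop
      (𝓝 0) := by
  choose 𝓑 hfin hbr hcov using fun j : ℕ =>
    exists_finite_brackets_orthant ν (show (0 : ℝ) < 1 / ((j : ℝ) + 1) by positivity)
  have hall : ∀ᵐ p ∂θ, ∀ j, ∀ B ∈ 𝓑 j,
      Tendsto (fun n => sampleFreq (v p n) B.1) atTop (𝓝 (ν.real B.1)) ∧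
      Tendsto (fun n => sampleFreq (v p n) B.2) atTop (𝓝 (ν.real B.2)) := by
    refine ae_all_iff.2 fun j => (ae_ball_iff (hfin j).countable).2 fun B hB => ?_
    exact (hv _ (hbr j B hB).1).and (hv _ (hbr j B hB).2.1)
  filter_upwards [hall] with p hp
  refine Metric.tendsto_atTop.2 fun ε hε => ?_
  obtain ⟨j, hj⟩ := exists_nat_one_div_lt (show 0 < ε / 2 by positivity)
  set δ : ℝ := 1 / ((j : ℝ) + 1) with hδ
  have hδ0 : 0 < δ := by positivity
  have hev : ∀ᶠ n in atTop, ∀ B ∈ 𝓑 j,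
      |sampleFreq (v p n) B.1 - ν.real B.1| < δ ∧ |sampleFreq (v p n) B.2 - ν.real B.2| < δ := by
    refine (hfin j).eventually_all.2 fun B hB => ?_
    exact ((Metric.tendsto_nhds.1 (hp j B hB).1) δ hδ0).and
      ((Metric.tendsto_nhds.1 (hp j B hB).2) δ hδ0)
  obtain ⟨N, hN⟩ := eventually_atTop.1 hev
  refine ⟨N, fun n hn => ?_⟩
  rw [Real.dist_eq, sub_zero, abs_of_nonneg (Real.iSup_nonneg fun _ => abs_nonneg _)]
  -- One `δ` is the sampling error on the two bracket sets, the other the gap between them.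
  refine lt_of_le_of_lt (ciSup_le fun x => ?_) (show 2 * δ < ε by linarith)
  obtain ⟨B, hB, hB1, hB2⟩ := hcov j x
  obtain ⟨h1, h2⟩ := hN n hn B hB
  have hdiff : ν.real B.2 - ν.real B.1 ≤ δ := by
    have h := measureReal_sdiff (μ := ν) (hB1.trans hB2) (hbr j B hB).1
    rw [← h]
    exact (hbr j B hB).2.2
  have f1 := sampleFreq_mono (v p n) hB1
  have f2 := sampleFreq_mono (v p n) hB2
  have m1 : ν.real B.1 ≤ ν.real (Set.Iic x) := measureReal_mono hB1
  have m2 : ν.real (Set.Iic x) ≤ ν.real B.2 := measureReal_mono hB2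
  rw [empiricalCDF_eq_sampleFreq]
  rw [abs_lt] at h1 h2
  rw [abs_le]
  constructor <;> linarith

end GlivenkoCantelli

/-! ### Sampling a field at random points. -/

section Main

variable {E : Type*} [NormedAddCommGroup E] [NormedSpace ℝ E] [MeasurableSpace E] [BorelSpace E]
  [FiniteDimensional ℝ E] {Ω : Type*} [MeasurableSpace Ω] {V : Type*} [MeasurableSpace V]
  {X : E → Ω → V} {P : Measure Ω} [IsProbabilityMeasure P]
  {Ω' : Type*} [MeasurableSpace Ω'] {Q : Measure Ω'} [IsProbabilityMeasure Q]

/-- The frontier of a convex set is null, so the sets may be taken open, hence measurable, without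
changing the uniform law. -/
theorem cond_interior_eq (μ : Measure E) [μ.IsAddHaarMeasure] {T : Set E} (hT : Convex ℝ T) :
    μ[|interior T] = μ[|T] := by
  have h := interior_ae_eq_of_null_frontier (hT.addHaar_frontier μ)
  simp only [ProbabilityTheory.cond, measure_congr h, Measure.restrict_congr_set h]

/-- Relative frequencies in a homogeneous ergodic field sampled at uniformly distributed random
points of increasing convex sets converge almost surely to probabilities. -/
theorem ae_tendsto_sampleFreq (μ : Measure E) [μ.IsAddHaarMeasure] {T : ℕ → Set E}
    (hmono : Monotone T) (hconv : ∀ n, Convex ℝ (T n)) {c : ℕ → E} {r : ℕ → ℝ}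
    (hr : Tendsto r atTop atTop) (hball : ∀ n, Metric.ball (c n) (r n) ⊆ T n)
    {k : ℕ → ℕ} (hk : StrictMono k) {η : (n : ℕ) → Fin (k n) → Ω' → E}
    (hη : ∀ n i, Measurable (η n i)) (hunif : ∀ n i, pdf.IsUniform (η n i) (T n) Q μ)
    (hind : ∀ n, iIndepFun (η n) Q)
    (hX : Measurable fun p : E × Ω => X p.1 p.2) (hom : IsHomogeneousField X P)
    (herg : IsErgodicField X P) {A : Set V} (hA : MeasurableSet A) :
    ∀ᵐ p ∂(P.prod Q), Tendsto (fun n => sampleFreq (fun i => X (η n i p.2) p.1) A) atTop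
      (𝓝 ((P.map (X 0)).real A)) := by
  -- Dropping the first `N` indices ensures nonempty balls and nonempty samples; `k 0` may be 0.
  obtain ⟨N, hN⟩ := eventually_atTop.1 ((hr.eventually_gt_atTop 0).and (eventually_ge_atTop 1))
  have hX0 : Measurable (X 0) := hX.comp (measurable_const.prodMk measurable_id)
  have hkpos : ∀ n, 0 < k (n + N) := fun n =>
    lt_of_lt_of_le ((hN (n + N) (by omega)).2) hk.le_apply
  let T' : ℕ → Set E := fun n => interior (T (n + N))
  have hball' : ∀ n, Metric.ball (c (n + N)) (r (n + N)) ⊆ T' n := fun n =>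
    interior_maximal (hball _) Metric.isOpen_ball
  have hne : ∀ n, (T' n).Nonempty := fun n =>
    ⟨_, hball' n (Metric.mem_ball_self (hN (n + N) (by omega)).1)⟩
  -- On a set of infinite volume the conditional measure is zero, which cannot be the law of a
  -- random point.
  have hfin : ∀ n, μ (T' n) ≠ ∞ := by
    intro n htop
    have h1 := hunif (n + N) ⟨0, hkpos n⟩
    have h2 : μ (T (n + N)) = ∞ := top_unique (htop ▸ measure_mono interior_subset)
    have := Measure.isProbabilityMeasure_map (μ := Q) (hη (n + N) ⟨0, hkpos n⟩).aemeasurable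
    rw [pdf.IsUniform, ProbabilityTheory.cond, h2, ENNReal.inv_top, zero_smul] at h1
    rw [h1] at this
    exact IsProbabilityMeasure.ne_zero (0 : Measure E) rfl
  let g : (E → V) → ℝ := fun x => A.indicator (fun _ => 1) (x 0)
  have hind1 : Measurable (A.indicator fun _ : V => (1 : ℝ)) := measurable_const.indicator hA
  have hg : Measurable g := hind1.comp (measurable_pi_apply 0)
  have h01 : ∀ y, A.indicator (fun _ : V => (1 : ℝ)) y ∈ Set.Icc (0 : ℝ) 1 := fun y => by
    by_cases h : y ∈ A <;> simp [h]
  have hgC : ∀ x, |g x| ≤ 1 := fun x => by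
    rw [abs_of_nonneg (h01 (x 0)).1]; exact (h01 (x 0)).2
  have hErg := ae_tendsto_average (P := P) μ (T := T')
    (fun n m h => interior_mono (hmono (by omega))) (fun n => (hconv _).interior)
    (fun n => isOpen_interior) hne hfin (hr.comp (tendsto_add_atTop_nat N)) hball' hX hom herg hg hgC
  have hmean : ∫ x, g x ∂fieldLaw X P = (P.map (X 0)).real A := by
    rw [fieldLaw, integral_map (measurable_path hX).aemeasurable hg.aestronglyMeasurable,
      map_measureReal_apply hX0 hA, ← integral_indicator_one (hX0 hA)]
    rfl
  rw [hmean] at hErg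
  have hsamp : ∀ n, Measurable fun p : Ω × Ω' => sampleFreq (fun i => X (η n i p.2) p.1) A := by
    intro n
    refine (Finset.measurable_fun_sum _ fun i _ => hind1.comp ?_).div_const _
    exact hX.comp (((hη n i).comp measurable_snd).prodMk measurable_fst)
  -- With `ω` frozen, only the points are random, so the row-wise strong law applies to one fixed
  -- function on `E`.
  refine (Measure.ae_prod_iff_ae_ae (measurableSet_tendsto _ hsamp)).2 ?_
  filter_upwards [hErg] with ω hω
  have hf : Measurable fun s => A.indicator (fun _ : V => (1 : ℝ)) (X s ω) :=
    hind1.comp (hX.comp (measurable_id.prodMk measurable_const))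
  have hlaw : ∀ n i, Q.map (η n i) = μ[|interior (T n)] := fun n i => by
    rw [cond_interior_eq μ (hconv n)]; exact hunif n i
  filter_upwards [ae_tendsto_sample_mean_sub hk hη hlaw hind hf fun s => h01 _] with ω' hω'
  rw [← tendsto_add_atTop_iff_nat N] at hω' ⊢
  have h := hω'.add hω
  simp only [zero_add] at h
  refine h.congr fun n => ?_
  simp only [g, T', pathShift, zero_add, sampleFreq, sub_add_cancel]

end Main

/-! ### Vector fields built from finitely many translates of a field. -/

section FiniteDimensional

variable {E : Type*} [AddCommGroup E] [MeasurableSpace E] {Ω : Type*} [MeasurableSpace Ω]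
  {V : Type*} [MeasurableSpace V] {X : E → Ω → V} {P : Measure Ω}

theorem IsHomogeneousField.finDim [IsProbabilityMeasure P] {l : ℕ} (hX : Measurable fun p : E × Ω => X p.1 p.2)
    (hom : IsHomogeneousField X P) (t : Fin l → E) :
    IsHomogeneousField (fun s ω (j : Fin l) => X (t j + s) ω) P := by
  intro h q s A hA
  let B : Set (E → V) := {x | ∀ i, (fun j => x (t j + s i)) ∈ A i}
  have hB : MeasurableSet B := by
    have : B = ⋂ i, (fun x : E → V => fun j => x (t j + s i)) ⁻¹' A i := by ext; simp [B]
    rw [this]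
    exact .iInter fun i => (measurable_pi_lambda _ fun j => measurable_pi_apply (t j + s i)) (hA i)
  have key := (hom.measurePreserving hX h).measure_preimage hB.nullMeasurableSet
  rw [fieldLaw, Measure.map_apply (measurable_path hX) hB,
    Measure.map_apply (measurable_path hX) (measurable_pathShift h hB)] at key
  convert key using 2
  · ext ω
    simp [B, pathShift, add_assoc]
  · rfl

/-- The map `Φ` commutes with shifts and carries one field law to the other, so invariant events
pull back to invariant events. -/
theorem IsErgodicField.finDim {l : ℕ} (hX : Measurable fun p : E × Ω => X p.1 p.2)
    (herg : IsErgodicField X P) (t : Fin l → E) :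
    IsErgodicField (fun s ω (j : Fin l) => X (t j + s) ω) P := by
  let Φ : (E → V) → E → Fin l → V := fun x s j => x (t j + s)
  have hΦ : Measurable Φ := measurable_pi_lambda _ fun s => measurable_pi_lambda _ fun j =>
    measurable_pi_apply (t j + s)
  have hlaw : fieldLaw (fun s ω (j : Fin l) => X (t j + s) ω) P = (fieldLaw X P).map Φ := by
    rw [fieldLaw, fieldLaw, Measure.map_map hΦ (measurable_path hX)]
    rfl
  intro A hA hinv
  rw [hlaw, Measure.map_apply hΦ hA]
  refine herg _ (hΦ hA) fun h => ?_
  have h1 := hinv h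
  rw [hlaw, Measure.map_apply hΦ (hA.symmDiff (measurable_pathShift h hA))] at h1
  convert h1 using 2
  ext x
  simp only [Set.mem_symmDiff, Set.mem_preimage]
  have : pathShift h (Φ x) = Φ (pathShift h x) := by
    funext s j
    simp [pathShift, Φ, add_assoc]
  rw [this]

end FiniteDimensional

theorem mainTheorem6 {m : ℕ}
    {Ω : Type*} [MeasurableSpace Ω] (P : Measure Ω) [IsProbabilityMeasure P]
    {Ω' : Type*} [MeasurableSpace Ω'] (Q : Measure Ω') [IsProbabilityMeasure Q]
    -- the increasing convex sets, containing balls of radii tending to infinity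
    (T : ℕ → Set (EuclideanSpace ℝ (Fin m)))
    (hT_mono : Monotone T)
    (hT_convex : ∀ n, Convex ℝ (T n))
    (hT_ball : ∃ (c : ℕ → EuclideanSpace ℝ (Fin m)) (r : ℕ → ℝ),
      Tendsto r atTop atTop ∧ ∀ n, Metric.ball (c n) (r n) ⊆ T n)
    -- the sample sizes and the randomizing points
    (k : ℕ → ℕ) (hk : StrictMono k)
    (η : (n : ℕ) → Fin (k n) → Ω' → EuclideanSpace ℝ (Fin m))
    (hη_meas : ∀ n i, Measurable (η n i))
    (hη_unif : ∀ n i, pdf.IsUniform (η n i) (T n) Q volume)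
    (hη_indep : ∀ n, iIndepFun (η n) Q) :
    -- vector-valued fields
    (∀ (l : ℕ) (X : EuclideanSpace ℝ (Fin m) → Ω → (Fin l → ℝ)),
      Measurable (fun p : EuclideanSpace ℝ (Fin m) × Ω => X p.1 p.2) →
      IsHomogeneousField X P → IsErgodicField X P →
      ∀ᵐ p ∂(P.prod Q),
        Tendsto (fun n => ⨆ x : Fin l → ℝ,
          |empiricalCDF (fun i => X (η n i p.2) p.1) x - multiCDF (X 0) P x|) atTop (𝓝 0)) ∧
    -- finite-dimensional distributions of scalar fields
    (∀ X : EuclideanSpace ℝ (Fin m) → Ω → ℝ,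
      Measurable (fun p : EuclideanSpace ℝ (Fin m) × Ω => X p.1 p.2) →
      IsHomogeneousField X P → IsErgodicField X P →
      ∀ (l : ℕ) (t : Fin l → EuclideanSpace ℝ (Fin m)),
      ∀ᵐ p ∂(P.prod Q),
        Tendsto (fun n => ⨆ x : Fin l → ℝ,
          |empiricalCDF (fun i j => X (t j + η n i p.2) p.1) x
            - multiCDF (fun ω j => X (t j) ω) P x|) atTop (𝓝 0)) := by
  obtain ⟨c, r, hr, hball⟩ := hT_ball
  have part1 : ∀ (l : ℕ) (X : EuclideanSpace ℝ (Fin m) → Ω → (Fin l → ℝ)),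
      Measurable (fun p : EuclideanSpace ℝ (Fin m) × Ω => X p.1 p.2) →
      IsHomogeneousField X P → IsErgodicField X P →
      ∀ᵐ p ∂(P.prod Q),
        Tendsto (fun n => ⨆ x : Fin l → ℝ,
          |empiricalCDF (fun i => X (η n i p.2) p.1) x - multiCDF (X 0) P x|) atTop (𝓝 0) := by
    intro l X hX hom herg
    have hX0 : Measurable (X 0) := hX.comp (measurable_const.prodMk measurable_id)
    have hcdf : ∀ x, multiCDF (X 0) P x = (P.map (X 0)).real (Set.Iic x) := fun x => by
      rw [map_measureReal_apply hX0 measurableSet_Iic]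
      rfl
    simp_rw [hcdf]
    have := Measure.isProbabilityMeasure_map (μ := P) hX0.aemeasurable
    exact ae_tendsto_iSup_abs_empiricalCDF_sub (P.map (X 0)) fun A hA =>
      ae_tendsto_sampleFreq volume hT_mono hT_convex hr hball hk hη_meas hη_unif hη_indep
        hX hom herg hA
  -- The vector field `s ↦ (X (t j + s))_j` at `s = 0` has the required joint law.
  refine ⟨part1, fun X hX hom herg l t => ?_⟩
  have hZ : Measurable fun p : EuclideanSpace ℝ (Fin m) × Ω => fun j : Fin l =>
      X (t j + p.1) p.2 :=
    measurable_pi_lambda _ fun j => hX.comp ((measurable_fst.const_add (t j)).prodMk measurable_snd)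
  simpa only [add_zero] using part1 l (fun s ω j => X (t j + s) ω) hZ (hom.finDim hX t)
    (herg.finDim hX t)
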